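/- Let $\mathbb N=\{1,2,\dots\}$ and, for a complex sequence $\xi$ and $k\in\mathbb Z$, let $|\xi|_k=(\sum_{j\ge1}|\xi_j|^2j^{2k})^{1/2}$. Let $s=\{\xi:|\xi|_n<\infty\text{ for all }n\ge0\}$ be the Fréchet space of rapidly decreasing sequences, with the norms $(|\cdot|_n)_{n\ge0}$, and let $s'=\{\xi:|\xi|_{-n}<\infty\text{ for some }n\ge0\}$ be the space of slowly increasing sequences, with the topology of the strong dual of $s$ under the pairing $\langle\eta,\xi\rangle=\sum_j\eta_j\overline{\xi_j}$ ($\eta\in s$, $\xi\in s'$); for $\xi\in s'$ and $\eta\in s$ put $\langle\xi,\eta\rangle=\overline{\langle\eta,\xi\rangle}$. For locally convex spaces $E,F$ let $L(E,F)$ be the space of continuous linear maps $E\to F$ with the topology of uniform convergence on bounded sets, and $L(E)=L(E,E)$. Let $\mathcal S=L(s',s)$ be the noncommutative Schwartz space, a $*$-algebra under composition (through the inclusion $s\subset s'$) and the involution determined by $\langle x\xi,\eta\rangle=\langle\xi,x^*\eta\rangle$ for $\xi,\eta\in s'$. Let $L(s)\cap L(s')$ be the algebra of all $u\in L(s)$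 that have a (necessarily unique) extension $\widetilde u\in L(s')$, with the coarsest topology for which $u\mapsto u\in L(s)$ and $u\mapsto\widetilde u\in L(s')$ are continuous, and with the involution determined by $\langle u\xi,\eta\rangle=\langle\xi,u^*\eta\rangle$ for $\xi,\eta\in s$. Let $\mathcal{DC}(\mathcal S)$ be the set of double centralizers of $\mathcal S$, i.e. of pairs $(L,R)$ of arbitrary maps $\mathcal S\to\mathcal S$ with $xL(y)=R(x)y$ for all $x,y\in\mathcal S$. It is a $*$-algebra with the pointwise linear operations, the product $(L_1,R_1)(L_2,R_2)=(L_1L_2,R_2R_1)$ and the involution $(L,R)^*=(R^*,L^*)$, where $T^*(x)=(T(x^*))^*$. For every $(L,R)\in\mathcal{DC}(\mathcal S)$ the maps $L$ and $R$ are linear and continuous, and $\mathcal{DC}(\mathcal S)$ carries the topology of a subspace of $L(\mathcal S)\times L(\mathcal S)$. Theorem. The map $u\mapsto(L_u,R_u)$, where $L_u(x)=ux$ and $R_u(x)=x\widetilde u$ for $x\in\mathcal S$, is an isomorphism of locally convex spaces and of $*$-algebras from $L(s)\cap L(s')$ onto $\mathcal{DC}(\mathcal S)$. Consequently, $\mathcal{DC}(\mathcal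 S)$ is a complete (Hausdorff) locally convex space and a topological $*$-algebra, i.e. its multiplication is separately continuous and its involution is continuous. -/

import Mathlib

namespace NCS

open scoped ComplexConjugate
open Topology Filter

noncomputable section

/-! ### Weighted sequence norms -/

/-- The norm `|ξ|_k = (∑ |ξ_j|² j^(2k))^(1/2)` for an integer exponent `k`. The index set
`ℕ+ = {1, 2, 3, …}`. -/
def wnorm (k : ℤ) (ξ : ℕ+ → ℂ) : ℝ :=
  Real.sqrt (∑' j : ℕ+, ‖ξ j‖ ^ 2 * ((j : ℕ) : ℝ) ^ (2 * k))

/-- `|ξ|_k < ∞`. -/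
def WFinite (k : ℤ) (ξ : ℕ+ → ℂ) : Prop :=
  Summable fun j : ℕ+ => ‖ξ j‖ ^ 2 * ((j : ℕ) : ℝ) ^ (2 * k)

theorem wt_pos (k : ℤ) (j : ℕ+) : (0 : ℝ) < ((j : ℕ) : ℝ) ^ k :=
  zpow_pos (by exact_mod_cast j.pos) k

theorem wt_ne (j : ℕ+) : ((j : ℕ) : ℂ) ≠ 0 := by exact_mod_cast j.pos.ne'

theorem norm_scaled (k : ℤ) (ξ : ℕ+ → ℂ) (j : ℕ+) :
    ‖((j : ℕ) : ℂ) ^ k * ξ j‖ = ‖ξ j‖ * ((j : ℕ) : ℝ) ^ k := by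
  rw [norm_mul, norm_zpow, Complex.norm_natCast, mul_comm]

theorem norm_scaled_sq (k : ℤ) (ξ : ℕ+ → ℂ) (j : ℕ+) :
    ‖((j : ℕ) : ℂ) ^ k * ξ j‖ ^ 2 = ‖ξ j‖ ^ 2 * ((j : ℕ) : ℝ) ^ (2 * k) := by
  rw [norm_scaled, mul_pow, mul_comm 2 k, zpow_mul]; norm_cast

theorem wfinite_iff (k : ℤ) (ξ : ℕ+ → ℂ) :
    WFinite k ξ ↔ Memℓp (fun j : ℕ+ => ((j : ℕ) : ℂ) ^ k * ξ j) 2 := by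
  rw [memℓp_gen_iff (by norm_num)]
  simp only [WFinite, ENNReal.toReal_ofNat, Real.rpow_ofNat, norm_scaled_sq]

/-- The `ℓ²` sequence `(j^k ξ_j)`. -/
def toL2 {k : ℤ} {ξ : ℕ+ → ℂ} (h : WFinite k ξ) : lp (fun _ : ℕ+ => ℂ) 2 :=
  ⟨fun j => ((j : ℕ) : ℂ) ^ k * ξ j, (wfinite_iff k ξ).1 h⟩

theorem toL2_apply {k : ℤ} {ξ : ℕ+ → ℂ} (h : WFinite k ξ) (j : ℕ+) :
    toL2 h j = ((j : ℕ) : ℂ) ^ k * ξ j := rfl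

theorem norm_toL2 {k : ℤ} {ξ : ℕ+ → ℂ} (h : WFinite k ξ) : ‖toL2 h‖ = wnorm k ξ := by
  rw [lp.norm_eq_tsum_rpow (by norm_num), wnorm, Real.sqrt_eq_rpow]
  simp only [ENNReal.toReal_ofNat, Real.rpow_ofNat, toL2_apply, norm_scaled_sq]

theorem wnorm_nonneg (k : ℤ) (ξ : ℕ+ → ℂ) : 0 ≤ wnorm k ξ := Real.sqrt_nonneg _

theorem WFinite.zero (k : ℤ) : WFinite k 0 := by simp [WFinite, summable_zero]

theorem WFinite.add {k : ℤ} {ξ η : ℕ+ → ℂ} (h : WFinite k ξ) (g : WFinite k η) :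
    WFinite k (ξ + η) := by
  rw [wfinite_iff] at *
  convert h.add g using 1
  ext j; simp [mul_add]

theorem WFinite.smul {k : ℤ} {ξ : ℕ+ → ℂ} (c : ℂ) (h : WFinite k ξ) : WFinite k (c • ξ) := by
  rw [wfinite_iff] at *
  convert h.const_smul c using 1
  ext j; simp; ring

theorem WFinite.mono {k l : ℤ} (hkl : k ≤ l) {ξ : ℕ+ → ℂ} (h : WFinite l ξ) : WFinite k ξ := by
  refine Summable.of_nonneg_of_le (fun j => ?_) (fun j => ?_) h
  · have := wt_pos (2 * k) j; positivity
  · gcongr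
    exact_mod_cast j.pos

theorem wnorm_zero (k : ℤ) : wnorm k 0 = 0 := by simp [wnorm]

theorem wnorm_add {k : ℤ} {ξ η : ℕ+ → ℂ} (h : WFinite k ξ) (g : WFinite k η) :
    wnorm k (ξ + η) ≤ wnorm k ξ + wnorm k η := by
  rw [← norm_toL2 h, ← norm_toL2 g, ← norm_toL2 (h.add g)]
  refine le_trans (le_of_eq ?_) (norm_add_le _ _)
  congr 1
  ext j; simp [toL2_apply, mul_add]

theorem wnorm_smul {k : ℤ} {ξ : ℕ+ → ℂ} (c : ℂ) (h : WFinite k ξ) :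
    wnorm k (c • ξ) = ‖c‖ * wnorm k ξ := by
  rw [← norm_toL2 h, ← norm_toL2 (h.smul c), ← norm_smul]
  congr 1
  ext j; simp [toL2_apply]; ring

theorem norm_apply_le {k : ℤ} {ξ : ℕ+ → ℂ} (h : WFinite k ξ) (j : ℕ+) :
    ‖ξ j‖ * ((j : ℕ) : ℝ) ^ k ≤ wnorm k ξ := by
  rw [← norm_toL2 h, ← norm_scaled]
  exact lp.norm_apply_le_norm (by norm_num) (toL2 h) j

theorem summable_pnat : Summable fun j : ℕ+ => ((j : ℕ) : ℝ) ^ (-2 : ℤ) := by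
  have h : Summable fun n : ℕ => ((n : ℝ) ^ 2)⁻¹ := Real.summable_nat_pow_inv.2 (by norm_num)
  have := h.comp_injective PNat.coe_injective
  refine this.congr fun j => ?_
  simp only [Function.comp]
  rw [zpow_neg]; norm_cast

/-- A sequence with `|ξ_j| j^(k+1) ≤ C` has a finite `k`-norm, bounded by a multiple of `C`. -/
theorem wfinite_of_bound {k : ℤ} {ξ : ℕ+ → ℂ} {C : ℝ}
    (h : ∀ j : ℕ+, ‖ξ j‖ * ((j : ℕ) : ℝ) ^ (k + 1) ≤ C) :
    WFinite k ξ ∧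
      wnorm k ξ ≤ Real.sqrt (∑' j : ℕ+, ((j : ℕ) : ℝ) ^ (-2 : ℤ)) * C := by
  have hC : 0 ≤ C := le_trans (mul_nonneg (norm_nonneg _) (wt_pos _ 1).le) (h 1)
  have key : ∀ j : ℕ+, ‖ξ j‖ ^ 2 * ((j : ℕ) : ℝ) ^ (2 * k) ≤
      ((j : ℕ) : ℝ) ^ (-2 : ℤ) * C ^ 2 := by
    intro j
    have hj : ((j : ℕ) : ℝ) ≠ 0 := by exact_mod_cast j.pos.ne'
    have e : ‖ξ j‖ ^ 2 * ((j : ℕ) : ℝ) ^ (2 * k) =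
        ((j : ℕ) : ℝ) ^ (-2 : ℤ) * (‖ξ j‖ * ((j : ℕ) : ℝ) ^ (k + 1)) ^ 2 := by
      rw [mul_pow, ← zpow_natCast (((j : ℕ) : ℝ) ^ (k + 1)), ← zpow_mul, mul_left_comm,
        ← zpow_add₀ hj]
      congr 2; push_cast; ring
    rw [e]
    have := wt_pos (-2) j
    have := h j
    have := wt_pos (k + 1) j
    gcongr
  have hs : Summable fun j : ℕ+ => ((j : ℕ) : ℝ) ^ (-2 : ℤ) * C ^ 2 := summable_pnat.mul_right _
  have hf : WFinite k ξ :=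
    Summable.of_nonneg_of_le (fun j => by have := wt_pos (2 * k) j; positivity) key hs
  refine ⟨hf, ?_⟩
  rw [wnorm]
  refine (Real.sqrt_le_sqrt (hf.tsum_le_tsum key hs)).trans ?_
  rw [tsum_mul_right, Real.sqrt_mul (tsum_nonneg fun j => (wt_pos _ j).le), Real.sqrt_sq hC]

theorem WFinite.summable_mul {k : ℤ} {η ξ : ℕ+ → ℂ} (h : WFinite k η) (g : WFinite (-k) ξ) :
    Summable (fun j => η j * conj (ξ j)) ∧
      ‖∑' j, η j * conj (ξ j)‖ ≤ wnorm k η * wnorm (-k) ξ := by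
  have e : ∀ j, inner ℂ (toL2 g j) (toL2 h j) = η j * conj (ξ j) := by
    intro j
    have hj := wt_ne j
    simp only [toL2_apply, RCLike.inner_apply, map_mul, zpow_neg, map_inv₀, map_zpow₀,
      Complex.conj_natCast]
    field_simp
  have s := lp.summable_inner (𝕜 := ℂ) (toL2 g) (toL2 h)
  have t := lp.inner_eq_tsum (𝕜 := ℂ) (toL2 g) (toL2 h)
  simp only [e] at s t
  refine ⟨s, ?_⟩
  rw [← t, ← norm_toL2 h, ← norm_toL2 g, mul_comm]
  exact norm_inner_le_norm _ _


/-! ### The sequence spaces `s` and `s'` -/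

/-- Rapidly decreasing sequences, as a subspace of all sequences. -/
def rapidSubmodule : Submodule ℂ (ℕ+ → ℂ) where
  carrier := {ξ | ∀ n : ℕ, WFinite n ξ}
  zero_mem' _ := WFinite.zero _
  add_mem' h g n := (h n).add (g n)
  smul_mem' c _ h n := (h n).smul c

/-- Slowly increasing sequences, as a subspace of all sequences. -/
def slowSubmodule : Submodule ℂ (ℕ+ → ℂ) where
  carrier := {ξ | ∃ n : ℕ, WFinite (-n) ξ}
  zero_mem' := ⟨0, WFinite.zero _⟩
  add_mem' := by
    rintro a b ⟨n, hn⟩ ⟨m, hm⟩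
    exact ⟨max n m, (hn.mono (by simp)).add (hm.mono (by simp))⟩
  smul_mem' c _ := fun ⟨n, hn⟩ => ⟨n, hn.smul c⟩

/-- The space `s` of rapidly decreasing sequences. A separate type, so that it does not inherit
the topology of pointwise convergence. -/
def Rapid : Type := rapidSubmodule

/-- The space `s'` of slowly increasing sequences. -/
def Slow : Type := slowSubmodule

instance : AddCommGroup Rapid := inferInstanceAs (AddCommGroup rapidSubmodule)
instance : Module ℂ Rapid := inferInstanceAs (Module ℂ rapidSubmodule)
instance : AddCommGroup Slow := inferInstanceAs (AddCommGroup slowSubmodule)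
instance : Module ℂ Slow := inferInstanceAs (Module ℂ slowSubmodule)

/-- The underlying sequence. -/
def Rapid.seq (ξ : Rapid) : ℕ+ → ℂ := ξ.1

/-- The underlying sequence. -/
def Slow.seq (ξ : Slow) : ℕ+ → ℂ := ξ.1

theorem Rapid.ext {ξ η : Rapid} (h : ∀ j, ξ.seq j = η.seq j) : ξ = η := Subtype.ext (funext h)
theorem Slow.ext {ξ η : Slow} (h : ∀ j, ξ.seq j = η.seq j) : ξ = η := Subtype.ext (funext h)
theorem Rapid.wfinite (ξ : Rapid) (n : ℕ) : WFinite n ξ.seq := ξ.2 n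
theorem Slow.wfinite (ξ : Slow) : ∃ n : ℕ, WFinite (-n) ξ.seq := ξ.2
@[simp] theorem Rapid.seq_zero : (0 : Rapid).seq = 0 := rfl
@[simp] theorem Slow.seq_zero : (0 : Slow).seq = 0 := rfl
@[simp] theorem Rapid.seq_add (ξ η : Rapid) : (ξ + η).seq = ξ.seq + η.seq := rfl
@[simp] theorem Slow.seq_add (ξ η : Slow) : (ξ + η).seq = ξ.seq + η.seq := rfl
@[simp] theorem Rapid.seq_smul (c : ℂ) (ξ : Rapid) : (c • ξ).seq = c • ξ.seq := rfl
@[simp] theorem Slow.seq_smul (c : ℂ) (ξ : Slow) : (c • ξ).seq = c • ξ.seq := rfl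

/-- The norms `|·|_n`, `n ∈ ℕ₀`, on `s`. -/
def rapidNorm : SeminormFamily ℂ Rapid ℕ := fun n =>
  Seminorm.of (fun ξ => wnorm n ξ.seq) (fun ξ η => wnorm_add (ξ.wfinite n) (η.wfinite n))
    (fun c ξ => wnorm_smul c (ξ.wfinite n))

@[simp] theorem rapidNorm_apply (n : ℕ) (ξ : Rapid) : rapidNorm n ξ = wnorm n ξ.seq := rfl

/-- The Fréchet topology (and uniformity) of `s`, given by the norms `|·|_n`. -/
instance : UniformSpace Rapid := rapidNorm.addGroupFilterBasis.uniformSpace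

theorem rapid_withSeminorms : WithSeminorms rapidNorm := ⟨rfl⟩

instance : IsUniformAddGroup Rapid := rapidNorm.addGroupFilterBasis.isUniformAddGroup
instance : ContinuousSMul ℂ Rapid := rapid_withSeminorms.continuousSMul

/-- The pairing `⟨η, ξ⟩ = ∑ η_j conj(ξ_j)` of `η ∈ s` and `ξ ∈ s'`. -/
def pair (η : Rapid) (ξ : Slow) : ℂ := ∑' j, η.seq j * conj (ξ.seq j)

theorem pair_summable (η : Rapid) (ξ : Slow) :
    Summable fun j => η.seq j * conj (ξ.seq j) := by
  obtain ⟨n, hn⟩ := ξ.wfinite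
  exact ((η.wfinite n).summable_mul hn).1

theorem norm_pair_le (η : Rapid) {ξ : Slow} {n : ℕ} (h : WFinite (-n) ξ.seq) :
    ‖pair η ξ‖ ≤ wnorm n η.seq * wnorm (-n) ξ.seq := ((η.wfinite n).summable_mul h).2

theorem pair_add_left (η η' : Rapid) (ξ : Slow) : pair (η + η') ξ = pair η ξ + pair η' ξ := by
  simp only [pair, Rapid.seq_add, Pi.add_apply, add_mul]
  exact (pair_summable η ξ).tsum_add (pair_summable η' ξ)

theorem pair_add_right (η : Rapid) (ξ ξ' : Slow) : pair η (ξ + ξ') = pair η ξ + pair η ξ' := by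
  simp only [pair, Slow.seq_add, Pi.add_apply, mul_add, map_add]
  exact (pair_summable η ξ).tsum_add (pair_summable η ξ')

theorem pair_smul_left (c : ℂ) (η : Rapid) (ξ : Slow) : pair (c • η) ξ = c * pair η ξ := by
  simp only [pair, Rapid.seq_smul, Pi.smul_apply, smul_eq_mul, mul_assoc]
  exact tsum_mul_left

theorem pair_smul_right (c : ℂ) (η : Rapid) (ξ : Slow) :
    pair η (c • ξ) = conj c * pair η ξ := by
  simp only [pair, Slow.seq_smul, Pi.smul_apply, smul_eq_mul, map_mul]
  rw [← tsum_mul_left]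
  exact tsum_congr fun j => mul_left_comm _ _ _

theorem continuous_of_bound {E F : Type*} [AddCommGroup E] [Module ℂ E] [TopologicalSpace E]
    [IsTopologicalAddGroup E] [SeminormedAddCommGroup F] [NormedSpace ℂ F] (f : E →ₗ[ℂ] F)
    (p : E → ℝ) (hp : Continuous p) (h0 : p 0 = 0) (h : ∀ x, ‖f x‖ ≤ p x) : Continuous f := by
  refine continuous_of_continuousAt_zero f ?_
  rw [ContinuousAt, map_zero]
  exact squeeze_zero_norm h (hp.tendsto' 0 0 h0)

theorem continuous_wnorm (n : ℕ) : Continuous fun ξ : Rapid => wnorm n ξ.seq :=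
  rapid_withSeminorms.continuous_seminorm n

/-- The element `ξ ∈ s'` as the continuous linear functional `⟨·, ξ⟩` on `s`. -/
def functional (ξ : Slow) : StrongDual ℂ Rapid where
  toFun η := pair η ξ
  map_add' η η' := pair_add_left η η' ξ
  map_smul' c η := pair_smul_left c η ξ
  cont := by
    obtain ⟨n, hn⟩ := ξ.wfinite
    exact continuous_of_bound
      (⟨⟨fun η => pair η ξ, fun η η' => pair_add_left η η' ξ⟩,
        fun c η => pair_smul_left c η ξ⟩ : Rapid →ₗ[ℂ] ℂ)
      (fun η => wnorm n η.seq * wnorm (-n) ξ.seq) ((continuous_wnorm n).mul continuous_const)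
      (by simp [wnorm_zero]) (fun η => norm_pair_le η hn)

@[simp] theorem functional_apply (ξ : Slow) (η : Rapid) : functional ξ η = pair η ξ := rfl

theorem pair_zero_left (ξ : Slow) : pair 0 ξ = 0 := map_zero (functional ξ)

theorem pair_zero_right (η : Rapid) : pair η 0 = 0 := by simp [pair]

/-- The conjugate-linear identification of `s'` with the dual of `s`. -/
def functionalₛₗ : Slow →ₛₗ[starRingEnd ℂ] StrongDual ℂ Rapid where
  toFun := functional
  map_add' ξ ξ' := by ext η; exact pair_add_right η ξ ξ'
  map_smul' c ξ := by ext η; exact pair_smul_right c η ξ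

/-- The topology of `s'`: that of the strong dual of `s`, i.e. uniform convergence on the bounded
subsets of `s`. -/
instance : TopologicalSpace Slow := TopologicalSpace.induced functional inferInstance

theorem functional_inducing : IsInducing functionalₛₗ := ⟨rfl⟩

instance : IsTopologicalAddGroup Slow := topologicalAddGroup_induced functionalₛₗ

instance : ContinuousSMul ℂ Slow :=
  functional_inducing.continuousSMul Complex.continuous_conj (by intro c x; exact map_smulₛₗ _ c x)

/-- The inclusion of `s` into `s'`. -/
def incl₀ (ξ : Rapid) : Slow :=
  ⟨ξ.seq, 0, by rw [Nat.cast_zero, neg_zero]; exact ξ.wfinite 0⟩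

theorem rapid_bounded {B : Set Rapid} (hB : Bornology.IsVonNBounded ℂ B) (n : ℕ) :
    ∃ r > 0, ∀ η ∈ B, wnorm n η.seq < r :=
  rapid_withSeminorms.isVonNBounded_iff_seminorm_bounded.1 hB n

/-- A linear map `f` into `s'` is continuous if for all bounded `B ⊂ s` the quantity
`sup_{η ∈ B} |⟨η, f x⟩|` is dominated by a continuous seminorm. -/
theorem continuous_to_slow {E : Type*} [AddCommGroup E] [Module ℂ E] [TopologicalSpace E]
    [IsTopologicalAddGroup E] (f : E →ₗ[ℂ] Slow)
    (h : ∀ B : Set Rapid, Bornology.IsVonNBounded ℂ B → ∃ p : E → ℝ, Continuous p ∧ p 0 = 0 ∧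
      ∀ η ∈ B, ∀ x, ‖pair η (f x)‖ ≤ p x) : Continuous f := by
  rw [functional_inducing.continuous_iff]
  have : ((functionalₛₗ : Slow → StrongDual ℂ Rapid) ∘ f) = ⇑(functionalₛₗ.comp f) := rfl
  rw [this]
  refine continuous_of_continuousAt_zero (functionalₛₗ.comp f) ?_
  rw [ContinuousAt, map_zero,
    (ContinuousLinearMap.hasBasis_nhds_zero_of_basis Metric.nhds_basis_ball).tendsto_right_iff]
  rintro ⟨B, r⟩ ⟨hB, hr⟩
  obtain ⟨p, hp, h0, hle⟩ := h B hB
  have : ∀ᶠ x in 𝓝 (0 : E), p x < r := (hp.tendsto' 0 0 h0).eventually (gt_mem_nhds hr)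
  filter_upwards [this] with x hx η hη
  exact mem_ball_zero_iff.2 ((hle η hη x).trans_lt hx)

/-- The continuous inclusion of `s` into `s'`. -/
def incl : Rapid →L[ℂ] Slow where
  toFun := incl₀
  map_add' _ _ := rfl
  map_smul' _ _ := rfl
  cont := by
    refine continuous_to_slow ⟨⟨incl₀, fun _ _ => rfl⟩, fun _ _ => rfl⟩ fun B hB => ?_
    obtain ⟨r, hr, hB⟩ := rapid_bounded hB 0
    refine ⟨fun ξ => r * wnorm (0 : ℕ) ξ.seq, ?_, ?_, fun η hη ξ => ?_⟩
    · exact continuous_const.mul (rapid_withSeminorms.continuous_seminorm 0)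
    · simp [wnorm_zero]
    · have h0 : WFinite (-(0 : ℕ)) (incl₀ ξ).seq := by
        rw [Nat.cast_zero, neg_zero]; exact ξ.wfinite 0
      have h2 : wnorm (-(0 : ℕ)) (incl₀ ξ).seq = wnorm (0 : ℕ) ξ.seq := by
        rw [Nat.cast_zero, neg_zero]; rfl
      have h3 := norm_pair_le η h0
      rw [h2] at h3
      exact h3.trans (mul_le_mul_of_nonneg_right (hB η hη).le (wnorm_nonneg _ _))

@[simp] theorem incl_seq (ξ : Rapid) : (incl ξ).seq = ξ.seq := rfl

theorem incl_injective : Function.Injective incl := fun _ _ h =>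
  Rapid.ext fun j => congrFun (congrArg Slow.seq h) j

theorem pair_incl (ξ η : Rapid) : pair ξ (incl η) = conj (pair η (incl ξ)) := by
  simp only [pair, incl_seq]
  rw [Complex.conj_tsum]
  simp [mul_comm]

/-! ### Unit vectors and expansions -/

/-- The unit vector `e_i` of `s`. -/
def basisVec (i : ℕ+) : Rapid :=
  ⟨Pi.single i 1, fun n => summable_of_ne_finset_zero (s := {i}) fun j hj => by
    rw [Finset.mem_singleton] at hj; simp [hj]⟩

theorem basisVec_seq (i : ℕ+) : (basisVec i).seq = Pi.single i 1 := rfl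

theorem wnorm_single (k : ℤ) (i : ℕ+) :
    wnorm k (Pi.single i 1) = ((i : ℕ) : ℝ) ^ k := by
  rw [wnorm, tsum_eq_single i (fun j hj => by simp [hj])]
  rw [Pi.single_eq_same, norm_one, one_pow, one_mul, mul_comm, zpow_mul]
  norm_cast
  rw [Real.sqrt_sq (wt_pos k i).le]

theorem pair_basisVec_left (i : ℕ+) (ξ : Slow) : pair (basisVec i) ξ = conj (ξ.seq i) := by
  rw [pair, tsum_eq_single i (fun j hj => by simp [basisVec_seq, hj])]
  simp [basisVec_seq]

theorem pair_basisVec_right (i : ℕ+) (η : Rapid) : pair η (incl (basisVec i)) = η.seq i := by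
  rw [pair_incl, pair_basisVec_left, incl_seq, Complex.conj_conj]

/-- The map `ξ ↦ (j^n ξ_j)` from `s` to `ℓ²`. -/
def rapidToL2 (n : ℕ) : Rapid →ₗ[ℂ] lp (fun _ : ℕ+ => ℂ) 2 where
  toFun ξ := toL2 (ξ.wfinite n)
  map_add' ξ η := by ext j; simp [toL2_apply, mul_add]
  map_smul' c ξ := by ext j; simp [toL2_apply, mul_left_comm]

theorem rapidToL2_apply (n : ℕ) (ξ : Rapid) (j : ℕ+) :
    rapidToL2 n ξ j = ((j : ℕ) : ℂ) ^ (n : ℤ) * ξ.seq j := rfl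

theorem norm_rapidToL2 (n : ℕ) (ξ : Rapid) : ‖rapidToL2 n ξ‖ = wnorm n ξ.seq :=
  norm_toL2 (ξ.wfinite n)

theorem rapidToL2_basis (n : ℕ) (ξ : Rapid) (i : ℕ+) :
    rapidToL2 n (ξ.seq i • basisVec i) = lp.single 2 i (rapidToL2 n ξ i) := by
  ext j
  rw [lp.single_apply, rapidToL2_apply, rapidToL2_apply, Rapid.seq_smul, basisVec_seq]
  by_cases h : j = i
  · subst h; simp
  · simp [h]

theorem rapid_hasSum (ξ : Rapid) : HasSum (fun i => ξ.seq i • basisVec i) ξ := by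
  rw [HasSum, SummationFilter.unconditional_filter, rapid_withSeminorms.tendsto_nhds]
  intro n ε hε
  have h := lp.hasSum_single (p := 2) (by norm_num) (rapidToL2 n ξ)
  rw [HasSum, SummationFilter.unconditional_filter, Metric.tendsto_nhds] at h
  filter_upwards [h ε hε] with F hF
  rw [dist_eq_norm] at hF
  rw [rapidNorm_apply, ← norm_rapidToL2, map_sub, map_sum]
  simpa only [rapidToL2_basis] using hF

theorem slowOfL2_mem (n : ℕ) (a : lp (fun _ : ℕ+ => ℂ) 2) :
    WFinite (-n) fun j => ((j : ℕ) : ℂ) ^ (n : ℤ) * a j := by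
  rw [wfinite_iff]
  convert lp.memℓp a using 2 with j
  rw [← mul_assoc, ← zpow_add₀ (wt_ne j)]; simp

/-- The map `a ↦ (j^n a_j)` from `ℓ²` to `s'`. -/
def slowOfL2 (n : ℕ) : lp (fun _ : ℕ+ => ℂ) 2 →ₗ[ℂ] Slow where
  toFun a := ⟨fun j => ((j : ℕ) : ℂ) ^ (n : ℤ) * a j, n, slowOfL2_mem n a⟩
  map_add' a b := Slow.ext fun j => mul_add _ (a j) (b j)
  map_smul' c a := Slow.ext fun j => mul_left_comm _ c (a j)

theorem slowOfL2_seq (n : ℕ) (a : lp (fun _ : ℕ+ => ℂ) 2) (j : ℕ+) :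
    (slowOfL2 n a).seq j = ((j : ℕ) : ℂ) ^ (n : ℤ) * a j := rfl

theorem slowOfL2_wnorm (n : ℕ) (a : lp (fun _ : ℕ+ => ℂ) 2) :
    wnorm (-n) (slowOfL2 n a).seq = ‖a‖ := by
  refine (norm_toL2 (slowOfL2_mem n a)).symm.trans ?_
  congr 1
  ext j
  rw [toL2_apply, ← mul_assoc, ← zpow_add₀ (wt_ne j)]; simp

theorem continuous_slowOfL2 (n : ℕ) : Continuous (slowOfL2 n) := by
  refine continuous_to_slow (slowOfL2 n) fun B hB => ?_
  obtain ⟨r, hr, hB⟩ := rapid_bounded hB n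
  refine ⟨fun a => r * ‖a‖, continuous_const.mul continuous_norm, ?_, fun η hη a => ?_⟩
  · simp
  · have h1 : WFinite (-n) (slowOfL2 n a).seq := slowOfL2_mem n a
    have h2 := norm_pair_le η h1
    rw [slowOfL2_wnorm] at h2
    exact h2.trans (mul_le_mul_of_nonneg_right (hB η hη).le (norm_nonneg a))

theorem slow_hasSum (ξ : Slow) : HasSum (fun i => ξ.seq i • incl (basisVec i)) ξ := by
  obtain ⟨n, hn⟩ := ξ.wfinite
  have h := (lp.hasSum_single (p := 2) (by norm_num) (toL2 hn)).map (slowOfL2 n)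
    (continuous_slowOfL2 n)
  have e : slowOfL2 n (toL2 hn) = ξ := Slow.ext fun j => by
    rw [slowOfL2_seq, toL2_apply, ← mul_assoc, ← zpow_add₀ (wt_ne j)]; simp
  rw [e] at h
  convert h using 2 with i
  refine Slow.ext fun j => ?_
  rw [Function.comp, slowOfL2_seq, lp.single_apply, toL2_apply]
  by_cases hj : j = i
  · subst hj
    rw [Pi.single_eq_same, ← mul_assoc, ← zpow_add₀ (wt_ne j)]; simp [basisVec_seq]
  · simp [basisVec_seq, hj]

theorem Rapid.ext_pair {ξ η : Rapid} (h : ∀ ζ : Slow, pair ξ ζ = pair η ζ) : ξ = η :=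
  Rapid.ext fun j => by simpa [pair_basisVec_right] using h (incl (basisVec j))

theorem Slow.ext_pair {ξ η : Slow} (h : ∀ ζ : Rapid, pair ζ ξ = pair ζ η) : ξ = η :=
  Slow.ext fun j => by
    have := h (basisVec j)
    rw [pair_basisVec_left, pair_basisVec_left] at this
    exact star_injective this

theorem continuous_pair_right (η : Rapid) : Continuous fun ξ : Slow => pair η ξ := by
  have : Continuous fun ξ : Slow => functionalₛₗ ξ η :=
    (ContinuousEvalConst.continuous_eval_const η).comp functional_inducing.continuous
  exact this

theorem continuous_pair_left (ξ : Slow) : Continuous fun η : Rapid => pair η ξ :=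
  (functional ξ).continuous

theorem slow_expand (g : Slow → ℂ) (hc : Continuous g) (hadd : ∀ x y, g (x + y) = g x + g y)
    (ξ : Slow) : HasSum (fun i => g (ξ.seq i • incl (basisVec i))) (g ξ) :=
  (slow_hasSum ξ).map (AddMonoidHom.mk' g hadd) hc

/-- The dual version of the unit vectors: `{i^n e_i}` is bounded in `s'`. -/
theorem slow_bounded_basis (n : ℕ) : Bornology.IsVonNBounded ℂ
    (Set.range fun i : ℕ+ => ((i : ℕ) : ℂ) ^ (n : ℤ) • incl (basisVec i)) := by
  have h := (NormedSpace.isVonNBounded_closedBall ℂ (lp (fun _ : ℕ+ => ℂ) 2) 1).image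
    (⟨slowOfL2 n, continuous_slowOfL2 n⟩ : lp (fun _ : ℕ+ => ℂ) 2 →L[ℂ] Slow)
  refine h.subset ?_
  rintro _ ⟨i, rfl⟩
  refine ⟨lp.single 2 i 1, ?_, Slow.ext fun j => ?_⟩
  · rw [mem_closedBall_zero_iff, lp.norm_single (by norm_num)]; simp
  · refine (slowOfL2_seq n _ j).trans ?_
    rw [lp.single_apply]
    by_cases hj : j = i
    · subst hj; simp [basisVec_seq]
    · simp [basisVec_seq, hj]

/-- A bounded subset of `s'` is bounded uniformly on every bounded subset of `s`. -/
theorem slow_bounded_pair {A : Set Slow} (hA : Bornology.IsVonNBounded ℂ A) {B : Set Rapid}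
    (hB : Bornology.IsVonNBounded ℂ B) : ∃ C : ℝ, ∀ η ∈ B, ∀ ζ ∈ A, ‖pair η ζ‖ ≤ C := by
  have h := hA.image (⟨functionalₛₗ, functional_inducing.continuous⟩ :
    Slow →SL[starRingEnd ℂ] StrongDual ℂ Rapid)
  have h2 := ContinuousLinearMap.isVonNBounded_image2_apply h hB
  rw [NormedSpace.isVonNBounded_iff, isBounded_iff_forall_norm_le] at h2
  obtain ⟨C, hC⟩ := h2
  exact ⟨C, fun η hη ζ hζ => hC _ ⟨_, ⟨ζ, hζ, rfl⟩, η, hη, rfl⟩⟩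

theorem slow_eventually {B : Set Rapid} (hB : Bornology.IsVonNBounded ℂ B) {r : ℝ} (hr : 0 < r) :
    ∀ᶠ ζ in 𝓝 (0 : Slow), ∀ η ∈ B, ‖pair η ζ‖ < r := by
  have h : Tendsto functionalₛₗ (𝓝 (0 : Slow)) (𝓝 0) :=
    functional_inducing.continuous.tendsto' _ _ (map_zero _)
  rw [(ContinuousLinearMap.hasBasis_nhds_zero_of_basis Metric.nhds_basis_ball).tendsto_right_iff]
    at h
  filter_upwards [h (B, r) ⟨hB, hr⟩] with ζ hζ η hη
  exact mem_ball_zero_iff.1 (hζ η hη)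

theorem wnorm_mono {k l : ℤ} (hkl : k ≤ l) {ξ : ℕ+ → ℂ} (h : WFinite l ξ) :
    wnorm k ξ ≤ wnorm l ξ := by
  refine Real.sqrt_le_sqrt ((h.mono hkl).tsum_le_tsum (fun j => ?_) h)
  gcongr
  exact_mod_cast j.pos

/-- A bounded subset of `s'` is equicontinuous on `s`. -/
theorem slow_bounded_equicontinuous {A : Set Slow} (hA : Bornology.IsVonNBounded ℂ A) :
    ∃ m : ℕ, ∃ C : ℝ, ∀ ζ ∈ A, ∀ η, ‖pair η ζ‖ ≤ C * wnorm m η.seq := by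
  by_contra! hcon
  have step : ∀ m : ℕ, ∃ η : Rapid, wnorm m η.seq ≤ 1 ∧ ∃ ζ ∈ A, (m : ℝ) < ‖pair η ζ‖ := by
    intro m
    obtain ⟨ζ, hζ, η, h⟩ := hcon m m
    have hpos : 0 < wnorm m η.seq := by
      by_contra hle
      have h0 : wnorm m η.seq = 0 := le_antisymm (not_lt.1 hle) (wnorm_nonneg _ _)
      have hz : η = 0 := by
        refine Rapid.ext fun j => ?_
        have h1 := norm_apply_le (η.wfinite m) j
        rw [h0] at h1
        have h2 := wt_pos m j
        have : ‖η.seq j‖ ≤ 0 := by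
          by_contra hh
          exact absurd h1 (not_le.2 (mul_pos (not_le.1 hh) h2))
        simpa using this
      subst hz
      have : pair 0 ζ = 0 := map_zero (functional ζ)
      rw [this, h0] at h
      simp at h
    refine ⟨((wnorm m η.seq : ℂ)⁻¹) • η, ?_, ζ, hζ, ?_⟩
    · rw [Rapid.seq_smul, wnorm_smul _ (η.wfinite m), norm_inv, Complex.norm_real,
        Real.norm_of_nonneg hpos.le, inv_mul_cancel₀ hpos.ne']
    · rw [pair_smul_left, norm_mul, norm_inv, Complex.norm_real, Real.norm_of_nonneg hpos.le,
        lt_inv_mul_iff₀ hpos, mul_comm]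
      exact h
  choose η hη hζ using step
  have hB : Bornology.IsVonNBounded ℂ (Set.range η) := by
    rw [rapid_withSeminorms.isVonNBounded_iff_seminorm_bounded]
    intro k
    have hs : 0 ≤ ∑ m ∈ Finset.range k, wnorm k (η m).seq :=
      Finset.sum_nonneg fun _ _ => wnorm_nonneg _ _
    refine ⟨2 + ∑ m ∈ Finset.range k, wnorm k (η m).seq, by linarith, ?_⟩
    rintro _ ⟨m, rfl⟩
    rw [rapidNorm_apply]
    by_cases hm : m < k
    · have := Finset.single_le_sum (f := fun m => wnorm k (η m).seq)
        (fun _ _ => wnorm_nonneg _ _) (Finset.mem_range.2 hm)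
      linarith
    · have := wnorm_mono (k := k) (l := m) (by exact_mod_cast not_lt.1 hm) ((η m).wfinite m)
      have := hη m
      linarith
  obtain ⟨C, hC⟩ := slow_bounded_pair hA hB
  obtain ⟨m, hm⟩ := exists_nat_gt C
  obtain ⟨ζ, hζA, hlt⟩ := hζ m
  have := hC _ ⟨m, rfl⟩ ζ hζA
  linarith

/-! ### The noncommutative Schwartz space `𝒮 = L(s', s)` -/

/-- The noncommutative Schwartz space: continuous linear operators from `s'` to `s`, with the
topology of uniform convergence on bounded sets. -/
abbrev NCSchwartz : Type := Slow →L[ℂ] Rapid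

/-- The product of `x, y : s' → s` is the composition `s' → s ↪ s' → s`. -/
instance : Mul NCSchwartz := ⟨fun x y => x ∘L incl ∘L y⟩

theorem mul_def (x y : NCSchwartz) (ξ : Slow) : (x * y) ξ = x (incl (y ξ)) := rfl

instance : NonUnitalRing NCSchwartz where
  left_distrib x y z := by ext ξ; simp [mul_def]
  right_distrib x y z := by ext ξ; simp [mul_def]
  zero_mul x := by ext ξ; simp [mul_def]
  mul_zero x := by ext ξ; simp [mul_def]
  mul_assoc x y z := by ext ξ; simp [mul_def]

instance : IsScalarTower ℂ NCSchwartz NCSchwartz := ⟨fun c x y => by ext ξ; simp [mul_def]⟩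
instance : SMulCommClass ℂ NCSchwartz NCSchwartz := ⟨fun c x y => by ext ξ; simp [mul_def]⟩

/-- The image under `x : s' → s` of the bounded set `{i^n e_i}`. -/
def colSet (x : NCSchwartz) (n : ℕ) : Set Rapid :=
  x '' Set.range fun i : ℕ+ => ((i : ℕ) : ℂ) ^ (n : ℤ) • incl (basisVec i)

theorem colSet_bounded (x : NCSchwartz) (n : ℕ) : Bornology.IsVonNBounded ℂ (colSet x n) :=
  (slow_bounded_basis n).image x

/-- The sequence `(⟨η, x e_i⟩)_i`. -/
def adjSeq (x : NCSchwartz) (η : Slow) (i : ℕ+) : ℂ := conj (pair (x (incl (basisVec i))) η)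

theorem adjSeq_bound (x : NCSchwartz) (η : Slow) (n : ℕ) {C : ℝ}
    (h : ∀ ζ ∈ colSet x (n + 1), ‖pair ζ η‖ ≤ C) (i : ℕ+) :
    ‖adjSeq x η i‖ * ((i : ℕ) : ℝ) ^ ((n : ℤ) + 1) ≤ C := by
  have := h _ ⟨_, ⟨i, rfl⟩, rfl⟩
  rw [map_smul, pair_smul_left, norm_mul, norm_zpow, Complex.norm_natCast] at this
  rw [adjSeq, RCLike.norm_conj, mul_comm]
  exact_mod_cast this

theorem adjSeq_wfinite (x : NCSchwartz) (η : Slow) (n : ℕ) : WFinite n (adjSeq x η) := by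
  obtain ⟨k, hk⟩ := η.wfinite
  obtain ⟨r, hr, h⟩ := rapid_bounded (colSet_bounded x (n + 1)) k
  refine (wfinite_of_bound (C := r * wnorm (-k) η.seq) (adjSeq_bound x η n fun ζ hζ => ?_)).1
  exact (norm_pair_le ζ hk).trans (mul_le_mul_of_nonneg_right (h ζ hζ).le (wnorm_nonneg _ _))

/-- The adjoint of `x` as a linear map. -/
def adjLin (x : NCSchwartz) : Slow →ₗ[ℂ] Rapid where
  toFun η := ⟨adjSeq x η, adjSeq_wfinite x η⟩
  map_add' η η' := Rapid.ext fun i => by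
    change adjSeq x (η + η') i = adjSeq x η i + adjSeq x η' i
    simp [adjSeq, pair_add_right]
  map_smul' c η := Rapid.ext fun i => by
    change adjSeq x (c • η) i = c * adjSeq x η i
    simp [adjSeq, pair_smul_right]

theorem adjLin_seq (x : NCSchwartz) (η : Slow) : (adjLin x η).seq = adjSeq x η := rfl

theorem continuous_adjLin (x : NCSchwartz) : Continuous (adjLin x) := by
  refine continuous_of_continuousAt_zero (adjLin x) ?_
  rw [ContinuousAt, map_zero, rapid_withSeminorms.tendsto_nhds]
  intro n ε hε
  set K := Real.sqrt (∑' j : ℕ+, ((j : ℕ) : ℝ) ^ (-2 : ℤ)) with hK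
  have hK0 : 0 ≤ K := Real.sqrt_nonneg _
  have hd : 0 < ε / (K + 1) := by positivity
  filter_upwards [slow_eventually (colSet_bounded x (n + 1)) hd] with η hη
  have h := (wfinite_of_bound (adjSeq_bound x η n fun ζ hζ => (hη ζ hζ).le)).2
  rw [sub_zero, rapidNorm_apply, adjLin_seq]
  refine h.trans_lt ?_
  rw [← hK, ← mul_div_assoc, div_lt_iff₀ (by positivity)]
  nlinarith

/-- The involution of `𝒮`: `⟨x^* η, ξ⟩ = ⟨η, x ξ⟩`, where `⟨η, x ξ⟩` is the conjugate of
`⟨x ξ, η⟩`. It is the restriction of the Hilbert space adjoint on `ℓ²`. -/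
instance : Star NCSchwartz := ⟨fun x => ⟨adjLin x, continuous_adjLin x⟩⟩

theorem star_seq (x : NCSchwartz) (η : Slow) (i : ℕ+) :
    (star x η).seq i = conj (pair (x (incl (basisVec i))) η) := rfl

theorem pair_star (x : NCSchwartz) (η ξ : Slow) : pair (star x η) ξ = conj (pair (x ξ) η) := by
  have h := slow_expand (fun ξ => conj (pair (x ξ) η))
    (Complex.continuous_conj.comp ((continuous_pair_left η).comp x.continuous))
    (fun a b => by simp [pair_add_left]) ξ
  rw [← h.tsum_eq, pair]
  refine tsum_congr fun i => ?_
  rw [star_seq, map_smul, pair_smul_left, map_mul, mul_comm]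

theorem eq_star {x y : NCSchwartz} (h : ∀ η ξ, pair (y η) ξ = conj (pair (x ξ) η)) :
    y = star x := by
  ext η
  exact Rapid.ext_pair fun ξ => by rw [h, pair_star]

instance : StarRing NCSchwartz where
  star_involutive x := (eq_star fun η ξ => by rw [pair_star, Complex.conj_conj]).symm
  star_mul x y := (eq_star fun η ξ => by
    rw [mul_def, mul_def, pair_star, pair_incl, Complex.conj_conj, pair_star]).symm
  star_add x y := (eq_star fun η ξ => by
    simp [pair_add_left, pair_star]).symm

instance : StarModule ℂ NCSchwartz := ⟨fun c x => (eq_star fun η ξ => by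
  simp [pair_smul_left, pair_star]).symm⟩

/-! ### The algebra `L(s) ∩ L(s')` -/

/-- Operators `x ∈ L(s)` together with an extension `x̃ ∈ L(s')`. The extension is unique, see
`MulAlg.ext_fst`. The topology is the one induced from `L(s)` and from `L(s')`. -/
def mulSubalgebra : Subalgebra ℂ ((Rapid →L[ℂ] Rapid) × (Slow →L[ℂ] Slow)) where
  carrier := {u | ∀ ξ, u.2 (incl ξ) = incl (u.1 ξ)}
  mul_mem' {u v} hu hv ξ := by
    change u.2 (v.2 (incl ξ)) = incl (u.1 (v.1 ξ))
    rw [hv, hu]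
  add_mem' {u v} hu hv ξ := by
    change u.2 (incl ξ) + v.2 (incl ξ) = incl (u.1 ξ + v.1 ξ)
    rw [hv, hu, map_add]
  algebraMap_mem' c ξ := rfl

/-- The algebra `L(s) ∩ L(s')`. -/
abbrev MulAlg : Type := mulSubalgebra

namespace MulAlg

/-- The operator `u : s → s`. -/
def onRapid (u : MulAlg) : Rapid →L[ℂ] Rapid := u.1.1

/-- The extension `ũ : s' → s'`. -/
def onSlow (u : MulAlg) : Slow →L[ℂ] Slow := u.1.2

theorem onSlow_incl (u : MulAlg) (ξ : Rapid) : u.onSlow (incl ξ) = incl (u.onRapid ξ) := u.2 ξ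

theorem ext_snd {u v : MulAlg} (h : ∀ ξ, u.onSlow ξ = v.onSlow ξ) : u = v := by
  refine Subtype.ext (Prod.ext ?_ (ContinuousLinearMap.ext h))
  ext ξ
  apply incl_injective
  exact (u.2 ξ).symm.trans ((h _).trans (v.2 ξ))

/-- The extension to `s'` is unique. -/
theorem ext_fst {u v : MulAlg} (h : ∀ ξ, u.onRapid ξ = v.onRapid ξ) : u = v := by
  refine ext_snd fun ξ => Slow.ext_pair fun ζ => ?_
  have e : ∀ w : MulAlg, HasSum (fun i => pair ζ (w.onSlow (ξ.seq i • incl (basisVec i))))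
      (pair ζ (w.onSlow ξ)) := fun w =>
    slow_expand (fun ξ => pair ζ (w.onSlow ξ))
      ((continuous_pair_right ζ).comp w.onSlow.continuous)
      (fun a b => by simp [pair_add_right]) ξ
  have e1 := e u
  have e2 := e v
  simp only [map_smul, onSlow_incl, h] at e1 e2
  exact e1.unique e2

end MulAlg

/-- Every continuous functional on `s` is `⟨·, ξ⟩` for some `ξ ∈ s'`. -/
theorem exists_functional (φ : StrongDual ℂ Rapid) : ∃ ξ : Slow, functional ξ = φ := by
  obtain ⟨t, C, -, hle⟩ := Seminorm.bound_of_continuous rapid_withSeminorms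
    ((normSeminorm ℂ ℂ).comp φ.toLinearMap) (continuous_norm.comp φ.continuous)
  set n := t.sup id
  have hb : ∀ i : ℕ+, ‖φ (basisVec i)‖ ≤ C * ((i : ℕ) : ℝ) ^ (n : ℤ) := by
    intro i
    have h1 : t.sup rapidNorm ≤ rapidNorm n := by
      refine Finset.sup_le fun k hk => ?_
      intro ξ
      have hkn : k ≤ n := Finset.le_sup (f := id) hk
      exact wnorm_mono (by exact_mod_cast hkn) (ξ.wfinite n)
    have h2 := hle (basisVec i)
    have h3 : t.sup rapidNorm (basisVec i) ≤ ((i : ℕ) : ℝ) ^ (n : ℤ) :=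
      (h1 _).trans (wnorm_single n i).le
    exact h2.trans (mul_le_mul_of_nonneg_left h3 C.2)
  have hf : WFinite (-((n + 1 : ℕ) : ℤ)) fun i => conj (φ (basisVec i)) := by
    refine (wfinite_of_bound (C := C) fun i => ?_).1
    have hi := wt_pos n i
    have e : -((n + 1 : ℕ) : ℤ) + 1 = -(n : ℤ) := by push_cast; ring
    rw [e, zpow_neg, RCLike.norm_conj, mul_inv_le_iff₀ hi]
    exact hb i
  refine ⟨⟨_, n + 1, hf⟩, ?_⟩
  ext ξ
  have h := (rapid_hasSum ξ).map φ φ.continuous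
  refine Eq.trans ?_ h.tsum_eq
  change ∑' j, ξ.seq j * conj (conj (φ (basisVec j))) = _
  refine tsum_congr fun i => ?_
  simp only [Function.comp, map_smul, smul_eq_mul, Complex.conj_conj]

namespace MulAlg

/-- The adjoint of `u : s → s` as a map `s' → s'`. -/
def adjFun (u : MulAlg) (η : Slow) : Slow :=
  (exists_functional (functional η ∘L u.onRapid)).choose

theorem functional_adjFun (u : MulAlg) (η : Slow) :
    functional (u.adjFun η) = functional η ∘L u.onRapid :=
  (exists_functional (functional η ∘L u.onRapid)).choose_spec

theorem pair_adjFun (u : MulAlg) (ξ : Rapid) (η : Slow) :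
    pair ξ (u.adjFun η) = pair (u.onRapid ξ) η :=
  congrArg (fun φ => φ ξ) (u.functional_adjFun η)

/-- The adjoint `s' → s'`. -/
def adjSlow (u : MulAlg) : Slow →L[ℂ] Slow where
  toFun := u.adjFun
  map_add' η η' := Slow.ext_pair fun ξ => by simp [pair_add_right, pair_adjFun]
  map_smul' c η := Slow.ext_pair fun ξ => by simp [pair_smul_right, pair_adjFun]
  cont := by
    rw [functional_inducing.continuous_iff]
    have : (functionalₛₗ : Slow → StrongDual ℂ Rapid) ∘ u.adjFun =
        ContinuousLinearMap.precomp ℂ u.onRapid ∘ functionalₛₗ :=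
      funext fun η => u.functional_adjFun η
    exact this ▸ (ContinuousLinearMap.precomp ℂ u.onRapid).continuous.comp
      functional_inducing.continuous

theorem pair_adjSlow (u : MulAlg) (ξ : Rapid) (η : Slow) :
    pair ξ (u.adjSlow η) = pair (u.onRapid ξ) η := u.pair_adjFun ξ η

theorem adj_bound (u : MulAlg) (n : ℕ) : ∃ m : ℕ, ∃ C : ℝ, ∀ η : Rapid, ∀ i : ℕ+,
    ‖(u.adjSlow (incl η)).seq i‖ * ((i : ℕ) : ℝ) ^ ((n : ℤ) + 1) ≤ C * wnorm m η.seq := by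
  obtain ⟨m, C, h⟩ := slow_bounded_equicontinuous ((slow_bounded_basis (n + 1)).image u.onSlow)
  refine ⟨m, C, fun η i => ?_⟩
  have := h _ ⟨_, ⟨i, rfl⟩, rfl⟩ η
  rw [map_smul, onSlow_incl, pair_smul_right, pair_incl, ← pair_adjSlow, pair_basisVec_left,
    norm_mul, RCLike.norm_conj, RCLike.norm_conj, RCLike.norm_conj, norm_zpow,
    Complex.norm_natCast, mul_comm] at this
  exact_mod_cast this

theorem adj_mem (u : MulAlg) (η : Rapid) (n : ℕ) : WFinite n (u.adjSlow (incl η)).seq := by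
  obtain ⟨m, C, h⟩ := u.adj_bound n
  exact (wfinite_of_bound (h η)).1

/-- The adjoint `s → s`, as a linear map. -/
def adjRapidLin (u : MulAlg) : Rapid →ₗ[ℂ] Rapid where
  toFun η := ⟨(u.adjSlow (incl η)).seq, u.adj_mem η⟩
  map_add' η η' := Rapid.ext fun i => by
    change (u.adjSlow (incl (η + η'))).seq i = _
    rw [map_add, map_add]; rfl
  map_smul' c η := Rapid.ext fun i => by
    change (u.adjSlow (incl (c • η))).seq i = _
    rw [map_smul, map_smul]; rfl

theorem continuous_adjRapidLin (u : MulAlg) : Continuous u.adjRapidLin := by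
  refine continuous_of_continuousAt_zero u.adjRapidLin ?_
  rw [ContinuousAt, map_zero, rapid_withSeminorms.tendsto_nhds]
  intro n ε hε
  obtain ⟨m, C, h⟩ := u.adj_bound n
  set K := Real.sqrt (∑' j : ℕ+, ((j : ℕ) : ℝ) ^ (-2 : ℤ)) with hK
  have h0 : Tendsto (fun η : Rapid => K * (C * wnorm m η.seq)) (𝓝 0) (𝓝 0) :=
    (continuous_const.mul (continuous_const.mul (continuous_wnorm m))).tendsto' _ _
      (by simp [wnorm_zero])
  filter_upwards [h0.eventually (gt_mem_nhds hε)] with η hη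
  rw [sub_zero]
  exact (wfinite_of_bound (h η)).2.trans_lt hη

/-- The involution of `L(s) ∩ L(s')`: `⟨ξ, u^* η⟩ = ⟨u ξ, η⟩`. -/
instance : Star MulAlg :=
  ⟨fun u => ⟨(⟨u.adjRapidLin, u.continuous_adjRapidLin⟩, u.adjSlow), fun _ => rfl⟩⟩

theorem pair_star (u : MulAlg) (ξ : Rapid) (η : Slow) :
    pair ξ ((star u).onSlow η) = pair (u.onRapid ξ) η := u.pair_adjSlow ξ η

theorem pair_star' (u : MulAlg) (η : Rapid) (ξ : Slow) :
    pair ((star u).onRapid η) ξ = pair η (u.onSlow ξ) := by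
  have h1 := slow_expand (fun ξ => pair ((star u).onRapid η) ξ) (continuous_pair_right _)
    (fun a b => pair_add_right _ a b) ξ
  have h2 := slow_expand (fun ξ => pair η (u.onSlow ξ))
    ((continuous_pair_right η).comp u.onSlow.continuous)
    (fun a b => by simp [pair_add_right]) ξ
  refine h1.unique ?_
  convert h2 using 2 with i
  rw [map_smul, pair_smul_right, pair_smul_right, onSlow_incl, pair_incl, ← onSlow_incl,
    pair_star, pair_incl η]

theorem eq_star {u v : MulAlg} (h : ∀ ξ η, pair ξ (v.onSlow η) = pair (u.onRapid ξ) η) :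
    v = star u :=
  ext_snd fun η => Slow.ext_pair fun ξ => by rw [h, pair_star]

theorem onRapid_mul (u v : MulAlg) (ξ : Rapid) : (u * v).onRapid ξ = u.onRapid (v.onRapid ξ) :=
  rfl
theorem onSlow_mul (u v : MulAlg) (ξ : Slow) : (u * v).onSlow ξ = u.onSlow (v.onSlow ξ) := rfl
theorem onRapid_add (u v : MulAlg) (ξ : Rapid) : (u + v).onRapid ξ = u.onRapid ξ + v.onRapid ξ :=
  rfl
theorem onSlow_add (u v : MulAlg) (ξ : Slow) : (u + v).onSlow ξ = u.onSlow ξ + v.onSlow ξ := rfl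
theorem onRapid_smul (c : ℂ) (u : MulAlg) (ξ : Rapid) : (c • u).onRapid ξ = c • u.onRapid ξ :=
  rfl
theorem onSlow_smul (c : ℂ) (u : MulAlg) (ξ : Slow) : (c • u).onSlow ξ = c • u.onSlow ξ := rfl

instance : StarRing MulAlg where
  star_involutive u := (eq_star fun ξ η => (u.pair_star' ξ η).symm).symm
  star_mul u v := (eq_star fun ξ η => by
    rw [onSlow_mul, onRapid_mul, pair_star, pair_star]).symm
  star_add u v := (eq_star fun ξ η => by
    rw [onSlow_add, onRapid_add, pair_add_right, pair_add_left, pair_star, pair_star]).symm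

instance : StarModule ℂ MulAlg := ⟨fun c u => (eq_star fun ξ η => by
  rw [onSlow_smul, onRapid_smul, pair_smul_right, pair_smul_left, pair_star]
  simp).symm⟩

end MulAlg

/-! ### Double centralizers -/

/-- An algebra is faithful if `x A = 0` implies `x = 0` and `A x = 0` implies `x = 0`. -/
class Faithful (A : Type*) [NonUnitalRing A] : Prop where
  left : ∀ x : A, (∀ y, x * y = 0) → x = 0
  right : ∀ x : A, (∀ y, y * x = 0) → x = 0

/-- A double centralizer on `A`: a pair `(L, R)` of arbitrary maps with `x L(y) = R(x) y`. -/
@[ext]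
structure DC (A : Type*) [Mul A] where
  /-- The map `L`. -/
  L : A → A
  /-- The map `R`. -/
  R : A → A
  central : ∀ x y, x * L y = R x * y

namespace DC

section Algebraic

variable {A : Type*} [NonUnitalRing A]

instance : Zero (DC A) := ⟨⟨fun _ => 0, fun _ => 0, fun x y => by simp⟩⟩
instance : One (DC A) := ⟨⟨fun x => x, fun x => x, fun _ _ => rfl⟩⟩
instance : Add (DC A) := ⟨fun p q => ⟨fun x => p.L x + q.L x, fun x => p.R x + q.R x,
  fun x y => by rw [mul_add, add_mul, p.central, q.central]⟩⟩
instance : Neg (DC A) := ⟨fun p => ⟨fun x => -p.L x, fun x => -p.R x,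
  fun x y => by rw [mul_neg, neg_mul, p.central]⟩⟩
instance [Module ℂ A] [IsScalarTower ℂ A A] [SMulCommClass ℂ A A] : SMul ℂ (DC A) :=
  ⟨fun c p => ⟨fun x => c • p.L x, fun x => c • p.R x,
    fun x y => by rw [mul_smul_comm, smul_mul_assoc, p.central]⟩⟩
/-- `(L₁, R₁) (L₂, R₂) = (L₁ L₂, R₂ R₁)`. -/
instance : Mul (DC A) := ⟨fun p q => ⟨fun x => p.L (q.L x), fun x => q.R (p.R x),
  fun x y => by rw [p.central, q.central]⟩⟩
/-- `(L, R)^* = (R^*, L^*)`, where `T^*(x) = T(x^*)^*`. -/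
instance [StarRing A] : Star (DC A) := ⟨fun p =>
  ⟨fun x => star (p.R (star x)), fun x => star (p.L (star x)), fun x y => by
    rw [← star_star x, ← star_mul, ← p.central, star_mul, star_star, star_star]⟩⟩

theorem L_add [Faithful A] (p : DC A) (x y : A) : p.L (x + y) = p.L x + p.L y := by
  refine sub_eq_zero.1 (Faithful.right _ fun z => ?_)
  rw [mul_sub, mul_add, p.central, p.central, p.central, mul_add, sub_self]

theorem R_add [Faithful A] (p : DC A) (x y : A) : p.R (x + y) = p.R x + p.R y := by
  refine sub_eq_zero.1 (Faithful.left _ fun z => ?_)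
  rw [sub_mul, add_mul, ← p.central, ← p.central, ← p.central, add_mul, sub_self]

theorem L_smul [Faithful A] [Module ℂ A] [IsScalarTower ℂ A A] [SMulCommClass ℂ A A]
    (p : DC A) (c : ℂ) (x : A) : p.L (c • x) = c • p.L x := by
  refine sub_eq_zero.1 (Faithful.right _ fun z => ?_)
  rw [mul_sub, mul_smul_comm, p.central, p.central, mul_smul_comm, sub_self]

theorem R_smul [Faithful A] [Module ℂ A] [IsScalarTower ℂ A A] [SMulCommClass ℂ A A]
    (p : DC A) (c : ℂ) (x : A) : p.R (c • x) = c • p.R x := by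
  refine sub_eq_zero.1 (Faithful.left _ fun z => ?_)
  rw [sub_mul, smul_mul_assoc, ← p.central, ← p.central, smul_mul_assoc, sub_self]

theorem ext_apply {p q : DC A} (hL : ∀ x, p.L x = q.L x) (hR : ∀ x, p.R x = q.R x) : p = q :=
  DC.ext (funext hL) (funext hR)

variable [Faithful A]

theorem L_zero (p : DC A) : p.L 0 = 0 := by simpa using p.L_add 0 0
theorem R_zero (p : DC A) : p.R 0 = 0 := by simpa using p.R_add 0 0

instance : Ring (DC A) where
  add_assoc p q r := ext_apply (fun _ => add_assoc _ _ _) (fun _ => add_assoc _ _ _)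
  zero_add p := ext_apply (fun _ => zero_add _) (fun _ => zero_add _)
  add_zero p := ext_apply (fun _ => add_zero _) (fun _ => add_zero _)
  add_comm p q := ext_apply (fun _ => add_comm _ _) (fun _ => add_comm _ _)
  neg_add_cancel p := ext_apply (fun _ => neg_add_cancel _) (fun _ => neg_add_cancel _)
  nsmul := nsmulRec
  zsmul := zsmulRec
  mul_assoc p q r := rfl
  one_mul p := rfl
  mul_one p := rfl
  zero_mul p := ext_apply (fun _ => rfl) (fun _ => p.R_zero)
  mul_zero p := ext_apply (fun _ => p.L_zero) (fun _ => rfl)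
  left_distrib p q r := ext_apply (fun _ => p.L_add _ _) (fun _ => rfl)
  right_distrib p q r := ext_apply (fun _ => rfl) (fun _ => r.R_add _ _)

variable [Module ℂ A] [IsScalarTower ℂ A A] [SMulCommClass ℂ A A]

instance : Module ℂ (DC A) where
  one_smul _ := ext_apply (fun _ => one_smul _ _) (fun _ => one_smul _ _)
  mul_smul _ _ _ := ext_apply (fun _ => mul_smul _ _ _) (fun _ => mul_smul _ _ _)
  smul_zero _ := ext_apply (fun _ => smul_zero _) (fun _ => smul_zero _)
  smul_add _ _ _ := ext_apply (fun _ => smul_add _ _ _) (fun _ => smul_add _ _ _)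
  add_smul _ _ _ := ext_apply (fun _ => add_smul _ _ _) (fun _ => add_smul _ _ _)
  zero_smul _ := ext_apply (fun _ => zero_smul _ _) (fun _ => zero_smul _ _)

instance : Algebra ℂ (DC A) := Algebra.ofModule
  (fun c p q => ext_apply (fun _ => rfl) (fun x => q.R_smul c (p.R x)))
  (fun c p q => ext_apply (fun x => p.L_smul c (q.L x)) (fun _ => rfl))

instance [StarRing A] : StarRing (DC A) where
  star_involutive p := ext_apply
    (fun x => by change star (star (p.L (star (star x)))) = _; simp)
    (fun x => by change star (star (p.R (star (star x)))) = _; simp)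
  star_mul p q := ext_apply
    (fun x => by
      change star (q.R (p.R (star x))) = star (q.R (star (star (p.R (star x))))); simp)
    (fun x => by
      change star (p.L (q.L (star x))) = star (p.L (star (star (q.L (star x))))); simp)
  star_add p q := ext_apply (fun x => star_add _ _) (fun x => star_add _ _)

instance [StarRing A] [StarModule ℂ A] : StarModule ℂ (DC A) :=
  ⟨fun _ _ => ext_apply (fun _ => star_smul _ _) (fun _ => star_smul _ _)⟩

end Algebraic

/-- The uniform structure, hence the topology, of uniform convergence of both `L` and `R` on the
bounded subsets of `A`. For pairs of continuous linear maps it is that of `L(A) × L(A)`. -/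
instance {A : Type*} [NonUnitalRing A] [Module ℂ A] [UniformSpace A] : UniformSpace (DC A) :=
  UniformSpace.comap
    (fun p => (UniformOnFun.ofFun {M : Set A | Bornology.IsVonNBounded ℂ M} p.L,
      UniformOnFun.ofFun {M : Set A | Bornology.IsVonNBounded ℂ M} p.R)) inferInstance

end DC

/-- The one-dimensional operator `⟨·, b⟩ a`. -/
def rankOne (a b : Rapid) : NCSchwartz where
  toFun ξ := conj (pair b ξ) • a
  map_add' ξ ξ' := by simp [pair_add_right, add_smul]
  map_smul' c ξ := by simp [pair_smul_right, mul_smul]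
  cont := (Complex.continuous_conj.comp (continuous_pair_right b)).smul continuous_const

theorem rankOne_apply (a b : Rapid) (ξ : Slow) : rankOne a b ξ = conj (pair b ξ) • a := rfl

instance : Faithful NCSchwartz where
  left x h := by
    have h0 : ∀ a, x (incl a) = 0 := fun a => by
      have := congrArg (fun y : NCSchwartz => y (incl (basisVec 1))) (h (rankOne a (basisVec 1)))
      simpa [mul_def, rankOne_apply, pair_basisVec_right, basisVec_seq] using this
    ext ξ
    have h1 := (slow_hasSum ξ).map x x.continuous
    have : (x ∘ fun i => ξ.seq i • incl (basisVec i)) = fun _ => 0 :=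
      funext fun i => by simp [h0]
    rw [this] at h1
    refine Rapid.ext_pair fun ζ => ?_
    have h2 := h1.map (functional ζ) (functional ζ).continuous
    simpa [pair_zero_left] using h2.tsum_eq.symm
  right x h := by
    ext ξ
    apply incl_injective
    refine Slow.ext_pair fun b => ?_
    have := congrArg (fun y : NCSchwartz => pair (y ξ) (incl (basisVec 1)))
      (h (rankOne (basisVec 1) b))
    simpa [mul_def, rankOne_apply, pair_smul_left, pair_basisVec_right, pair_zero_right, pair_zero_left,
      basisVec_seq] using this

/-- The map `u ↦ (L_u, R_u)`, `L_u x = u x`, `R_u x = x ũ`. -/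
def doubleRep (u : MulAlg) : DC NCSchwartz where
  L x := u.onRapid ∘L x
  R x := x ∘L u.onSlow
  central x y := by ext ξ; simp [mul_def, MulAlg.onSlow_incl]

end

end NCS

/-!
Throughout, `e₁` is the first unit vector and `⟨·, b⟩ a` is the one-dimensional operator
`rankOne a b` of `𝒮 = L(s', s)`.

**Bijectivity.** Let `(L, R)` be a double centralizer. The operator `u a = L(⟨·, e₁⟩ a) e₁` on `s`
satisfies `⟨u a, b⟩ = (R(⟨·, b⟩ e₁) a)₁`, which is the identity `x L(y) = R(x) y` for one-dimensional
`x` and `y`. Hence all coordinates of `u a` depend continuously on `a`, and `u` is continuous because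
`s` is barrelled (`continuous_of_continuous_coord`, which replaces the closed graph theorem). The same
construction applied to `(L, R)^*` yields an operator `v` on `s` with `⟨u a, b⟩ = ⟨a, v b⟩`
(`DC.pair_symbol_star`), so the transpose of `v` extends `u` to `s'`. From `L(x y) = L(x) y` with
one-dimensional `y` one gets `L(x) = u x` on `s`, hence on `s'` by density, and then `R(x) = x ũ`
because `𝒮` is faithful (`DC.L_eq`, `DC.R_eq`).

**Topology.** That `u` is small on bounded subsets of `s` implies that `u x` is small when `x` runs
through a bounded subset of `𝒮`; for `x ũ` one passes to the adjoints, which is possible since the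
involution of `𝒮` is continuous. Conversely `u` and `ũ` are recovered from `L` and `R` by testing on
one-dimensional operators, and bounded sets of vectors give bounded sets of such operators
(`isVonNBounded_rankOne`).

**Completeness.** A uniform limit on bounded sets of operators in `𝒮` is linear and maps bounded sets
to bounded sets; such a map is continuous (`continuous_of_isVonNBounded_image`), so `𝒮` is complete.
Since double centralizers are pairs of arbitrary maps subject to a closed condition, they form a
closed subspace of a complete space of maps.
-/

namespace NCS

open scoped ComplexConjugate
open Topology Filter

noncomputable section

/-! ### The Fréchet space `s` -/

/-- The weighted `ℓ²` norm is small if a slightly heavier weighted supremum norm is small. -/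
theorem exists_wnorm_lt (k : ℤ) {ε : ℝ} (hε : 0 < ε) : ∃ δ > 0, ∀ {ξ : ℕ+ → ℂ},
    (∀ j : ℕ+, ‖ξ j‖ * ((j : ℕ) : ℝ) ^ (k + 1) ≤ δ) → wnorm k ξ < ε := by
  set K := Real.sqrt (∑' j : ℕ+, ((j : ℕ) : ℝ) ^ (-2 : ℤ)) with hK
  have hK0 : 0 ≤ K := Real.sqrt_nonneg _
  refine ⟨ε / (K + 1), by positivity, fun h => (wfinite_of_bound h).2.trans_lt ?_⟩
  rw [← hK, ← mul_div_assoc, div_lt_iff₀ (by positivity)]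
  nlinarith

theorem rapidNorm_zero_eq_zero {ξ : Rapid} (h : rapidNorm 0 ξ = 0) : ξ = 0 := by
  refine Rapid.ext fun j => norm_le_zero_iff.1 ?_
  have := norm_apply_le (ξ.wfinite 0) j
  rw [← rapidNorm_apply, h] at this
  simpa using this

instance : T2Space Rapid := by
  have : T1Space Rapid := rapid_withSeminorms.T1_of_separating fun ξ hξ => by
    by_contra! h
    exact hξ (rapidNorm_zero_eq_zero (h 0))
  infer_instance

instance : LocallyConvexSpace ℝ Rapid := rapid_withSeminorms.toLocallyConvexSpace

instance : FirstCountableTopology Rapid := rapid_withSeminorms.firstCountableTopology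

/-- The space `s` as a uniform subspace of a countable product of copies of `ℓ²`. -/
theorem rapid_isUniformInducing :
    IsUniformInducing fun (ξ : Rapid) (n : ℕ) => rapidToL2 n ξ := by
  refine AddMonoidHom.isUniformInducing_of_isInducing
    (f := (LinearMap.pi fun n => rapidToL2 n : Rapid →ₗ[ℂ] _).toAddMonoidHom) ?_
  refine isInducing_iff_nhds.2 fun x => le_antisymm ?_ ?_
  · refine Filter.map_le_iff_le_comap.1 ?_
    refine (continuous_pi fun n => ?_ :
      Continuous fun (ξ : Rapid) (n : ℕ) => rapidToL2 n ξ).tendsto x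
    exact continuous_of_bound (rapidToL2 n) _ (continuous_wnorm n) (by simp [wnorm_zero])
      fun ξ => (norm_rapidToL2 n ξ).le
  · refine tendsto_id'.1 ((rapid_withSeminorms.tendsto_nhds id x).2 fun n ε hε => ?_)
    have h : Tendsto (fun ξ : Rapid => rapidToL2 n ξ)
        (comap (fun (ξ : Rapid) (n : ℕ) => rapidToL2 n ξ) (𝓝 fun n => rapidToL2 n x))
        (𝓝 (rapidToL2 n x)) :=
      ((continuous_apply (A := fun _ : ℕ => lp (fun _ : ℕ+ => ℂ) 2) n).tendsto
        fun n => rapidToL2 n x).comp tendsto_comap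
    rw [Metric.tendsto_nhds] at h
    filter_upwards [h ε hε] with ξ hξ
    rwa [dist_eq_norm, ← map_sub, norm_rapidToL2] at hξ

/-- The image of `s` in the product of copies of `ℓ²` consists of the families whose members are the
rescalings `(j^n a_j)` of one sequence `a`, which is a closed condition. -/
instance : CompleteSpace Rapid := by
  rw [completeSpace_iff_isComplete_range rapid_isUniformInducing]
  refine IsClosed.isComplete ?_
  have : (Set.range fun (ξ : Rapid) (n : ℕ) => rapidToL2 n ξ) =
      {a | ∀ (n : ℕ) (j : ℕ+), a n j = ((j : ℕ) : ℂ) ^ (n : ℤ) * a 0 j} := by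
    refine Set.ext fun a => ⟨?_, fun h => ?_⟩
    · rintro ⟨ξ, rfl⟩ n j
      simp [rapidToL2_apply]
    · refine ⟨⟨fun j => a 0 j, fun n => ?_⟩, ?_⟩
      · rw [wfinite_iff]
        have e : (fun j : ℕ+ => ((j : ℕ) : ℂ) ^ (n : ℤ) * a 0 j) = a n :=
          funext fun j => (h n j).symm
        rw [e]
        exact lp.memℓp (a n)
      · ext n j
        exact (h n j).symm
  rw [this, Set.ofPred_forall]
  refine isClosed_iInter fun n => ?_
  rw [Set.ofPred_forall]
  refine isClosed_iInter fun j => ?_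
  have hc : ∀ k : ℕ, Continuous fun a : ℕ → lp (fun _ : ℕ+ => ℂ) 2 => a k j := fun k =>
    ((lp.evalCLM ℂ (fun _ : ℕ+ => ℂ) 2 j).continuous).comp (continuous_apply k)
  exact isClosed_eq (hc n) (continuous_const.mul (hc 0))

instance : BarrelledSpace ℂ Rapid := by
  have : (uniformity Rapid).IsCountablyGenerated :=
    IsUniformAddGroup.uniformity_countably_generated
  infer_instance

/-- A linear map `T : s → s` all of whose coordinate functionals are continuous is continuous. This is
the closed graph theorem in the form needed here; it follows from barrelledness, since `|T ξ|_n` is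
dominated by the supremum of the continuous seminorms `ξ ↦ |(T ξ)_i| i^(n+1)`. -/
theorem continuous_of_continuous_coord (T : Rapid →ₗ[ℂ] Rapid)
    (hT : ∀ i, Continuous fun ξ => (T ξ).seq i) : Continuous T := by
  refine continuous_of_continuousAt_zero T ?_
  rw [ContinuousAt, map_zero, rapid_withSeminorms.tendsto_nhds]
  intro n ε hε
  let c : ℕ+ → Rapid →ₗ[ℂ] ℂ := fun i =>
    { toFun := fun ξ => ((i : ℕ) : ℂ) ^ ((n : ℤ) + 1) * (T ξ).seq i
      map_add' := fun ξ η => by simp [mul_add]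
      map_smul' := fun a ξ => by simp [mul_left_comm] }
  let q : ℕ+ → Seminorm ℂ Rapid := fun i => (normSeminorm ℂ ℂ).comp (c i)
  have hq : ∀ i ξ, q i ξ = ‖(T ξ).seq i‖ * ((i : ℕ) : ℝ) ^ ((n : ℤ) + 1) := fun i ξ =>
    norm_scaled _ _ _
  have hqc : ∀ i, Continuous (q i) := fun i => (continuous_const.mul (hT i)).norm
  have hbdd : BddAbove (Set.range q) := by
    rw [Seminorm.bddAbove_range_iff]
    rintro ξ
    refine ⟨wnorm ((n + 1 : ℕ) : ℤ) (T ξ).seq, ?_⟩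
    rintro _ ⟨i, rfl⟩
    exact (hq i ξ).trans_le (norm_apply_le ((T ξ).wfinite (n + 1)) i)
  have hsup := Seminorm.continuous_iSup q hqc hbdd
  set K := Real.sqrt (∑' j : ℕ+, ((j : ℕ) : ℝ) ^ (-2 : ℤ))
  have h0 : Tendsto (fun ξ : Rapid => K * (⨆ i, q i) ξ) (𝓝 0) (𝓝 0) := by
    rw [← Seminorm.coe_iSup_eq hbdd] at hsup
    exact (continuous_const.mul hsup).tendsto' 0 0 (by simp)
  filter_upwards [h0.eventually (gt_mem_nhds hε)] with ξ hξ
  rw [sub_zero]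
  refine (wfinite_of_bound fun i => ?_).2.trans_lt hξ
  rw [← hq, Seminorm.iSup_apply hbdd]
  exact le_ciSup ((Seminorm.bddAbove_range_iff.1 hbdd) ξ) i

/-! ### Zero neighbourhoods in spaces of operators -/

section Tendsto

variable {E ι : Type*} [AddCommGroup E] [Module ℂ E] [TopologicalSpace E] {l : Filter ι}

theorem tendsto_rapid_zero_iff {f : ι → E →L[ℂ] Rapid} :
    Tendsto f l (𝓝 0) ↔ ∀ B : Set E, Bornology.IsVonNBounded ℂ B → ∀ (n : ℕ), ∀ ε > 0,
      ∀ᶠ i in l, ∀ x ∈ B, wnorm n (f i x).seq < ε := by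
  refine ⟨fun h B hB n ε hε => ?_, fun h => ?_⟩
  · have hU : {ξ : Rapid | wnorm n ξ.seq < ε} ∈ 𝓝 0 :=
      ((continuous_wnorm n).tendsto' 0 0 (by simp [wnorm_zero])).eventually (gt_mem_nhds hε)
    filter_upwards [h.eventually (ContinuousLinearMap.eventually_nhds_zero_mapsTo hB hU)]
      with i hi x hx using hi hx
  · rw [(ContinuousLinearMap.hasBasis_nhds_zero_of_basis
      rapid_withSeminorms.hasBasis_zero_ball).tendsto_right_iff]
    rintro ⟨B, s, r⟩ ⟨hB, hr⟩
    have := (Filter.eventually_all_finset s).2 fun n _ => h B hB n r hr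
    filter_upwards [this] with i hi x hx
    rw [Seminorm.mem_ball_zero]
    exact Seminorm.finset_sup_apply_lt hr fun n hn => hi n hn x hx

theorem slow_hasBasis_nhds_zero : (𝓝 (0 : Slow)).HasBasis
    (fun Dr : Set Rapid × ℝ => Bornology.IsVonNBounded ℂ Dr.1 ∧ 0 < Dr.2)
    fun Dr => {ξ | ∀ η ∈ Dr.1, ‖pair η ξ‖ < Dr.2} := by
  have h := (ContinuousLinearMap.hasBasis_nhds_zero_of_basis (E := Rapid) (F := ℂ)
    (σ := RingHom.id ℂ) Metric.nhds_basis_ball).comap functionalₛₗ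
  rw [← map_zero functionalₛₗ, ← functional_inducing.nhds_eq_comap] at h
  refine h.congr (fun _ => Iff.rfl) fun _ _ => ?_
  ext ξ
  exact forall₂_congr fun η _ => mem_ball_zero_iff

theorem tendsto_slow_zero_iff {f : ι → E →L[ℂ] Slow} :
    Tendsto f l (𝓝 0) ↔ ∀ B : Set E, Bornology.IsVonNBounded ℂ B →
      ∀ D : Set Rapid, Bornology.IsVonNBounded ℂ D → ∀ ε > 0,
      ∀ᶠ i in l, ∀ x ∈ B, ∀ η ∈ D, ‖pair η (f i x)‖ < ε := by
  rw [(ContinuousLinearMap.hasBasis_nhds_zero_of_basis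
    slow_hasBasis_nhds_zero).tendsto_right_iff]
  exact ⟨fun h B hB D hD ε hε => h (B, D, ε) ⟨hB, hD, hε⟩,
    fun h ⟨B, D, ε⟩ hBD => h B hBD.1 D hBD.2.1 ε hBD.2.2⟩

end Tendsto

theorem tendsto_nCSchwartz_end_zero_iff {ι : Type*} {l : Filter ι}
    {f : ι → NCSchwartz →L[ℂ] NCSchwartz} :
    Tendsto f l (𝓝 0) ↔ ∀ M : Set NCSchwartz, Bornology.IsVonNBounded ℂ M →
      ∀ B : Set Slow, Bornology.IsVonNBounded ℂ B → ∀ (n : ℕ), ∀ ε > 0,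
      ∀ᶠ i in l, ∀ x ∈ M, ∀ ξ ∈ B, wnorm n (f i x ξ).seq < ε := by
  refine ⟨fun h M hM B hB n ε hε => ?_, fun h => ?_⟩
  · have hU : ∀ᶠ y : NCSchwartz in 𝓝 0, ∀ ξ ∈ B, wnorm n (y ξ).seq < ε :=
      tendsto_rapid_zero_iff.1 tendsto_id B hB n ε hε
    filter_upwards [h.eventually (ContinuousLinearMap.eventually_nhds_zero_mapsTo hM hU)]
      with i hi x hx using hi hx
  · rw [(ContinuousLinearMap.hasBasis_nhds_zero_of_basis
      (ContinuousLinearMap.hasBasis_nhds_zero_of_basis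
      rapid_withSeminorms.hasBasis_zero_ball)).tendsto_right_iff]
    rintro ⟨M, B, s, r⟩ ⟨hM, hB, hr⟩
    have := (Filter.eventually_all_finset s).2 fun n _ => h M hM B hB n r hr
    filter_upwards [this] with i hi x hx ξ hξ
    rw [Seminorm.mem_ball_zero]
    exact Seminorm.finset_sup_apply_lt hr fun n hn => hi n hn x hx ξ hξ

/-! ### Completeness and involution of `𝒮` -/

/-- The space `s'` is bornological as far as maps into `s` are concerned. For a linear `f : s' → s`
that maps bounded sets to bounded sets, the rows of the matrix of `f`, suitably weighted, form a
bounded subset of `s`, and `|f ξ|_n` is controlled by the pairing of `ξ` with this set. -/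
theorem continuous_of_isVonNBounded_image (f : Slow →ₗ[ℂ] Rapid)
    (hf : ∀ B, Bornology.IsVonNBounded ℂ B → Bornology.IsVonNBounded ℂ (f '' B)) :
    Continuous f := by
  -- `f` is continuous on each of the Hilbert spaces whose union is `s'`
  have hL2 : ∀ m : ℕ, Continuous (f ∘ₗ slowOfL2 m) := fun m => by
    refine LinearMap.continuous_of_locally_bounded _ fun B hB => ?_
    have := hf _ (hB.image
      (⟨slowOfL2 m, continuous_slowOfL2 m⟩ : lp (fun _ : ℕ+ => ℂ) 2 →L[ℂ] Slow))
    rwa [← Set.image_comp] at this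
  have hsum : ∀ ξ : Slow, HasSum (fun k => ξ.seq k • f (incl (basisVec k))) (f ξ) := by
    intro ξ
    obtain ⟨m, hm⟩ := ξ.wfinite
    have h := (lp.hasSum_single (p := 2) (by norm_num) (toL2 hm)).map (f ∘ₗ slowOfL2 m) (hL2 m)
    have e : slowOfL2 m (toL2 hm) = ξ := Slow.ext fun j => by
      rw [slowOfL2_seq, toL2_apply, ← mul_assoc, ← zpow_add₀ (wt_ne j)]; simp
    rw [LinearMap.comp_apply, e] at h
    convert h using 2 with i
    rw [Function.comp, LinearMap.comp_apply, ← map_smul]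
    congr 1
    refine Slow.ext fun j => ?_
    rw [slowOfL2_seq, lp.single_apply, toL2_apply]
    by_cases hj : j = i
    · subst hj
      rw [Pi.single_eq_same, ← mul_assoc, ← zpow_add₀ (wt_ne j)]; simp [basisVec_seq]
    · simp [basisVec_seq, hj]
  refine continuous_of_continuousAt_zero f ?_
  rw [ContinuousAt, map_zero, rapid_withSeminorms.tendsto_nhds]
  intro n ε hε
  -- the conjugate of the `i`-th row of the matrix of `f`, scaled by `i^(n+1)`
  let d₀ : ℕ+ → ℕ+ → ℂ := fun i k =>
    conj (((i : ℕ) : ℂ) ^ ((n : ℤ) + 1) * (f (incl (basisVec k))).seq i)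
  have hd : ∀ m : ℕ, ∃ C : ℝ, ∀ i k, ‖d₀ i k‖ * ((k : ℕ) : ℝ) ^ ((m : ℤ) + 1) ≤ C := by
    intro m
    obtain ⟨r, -, hr⟩ := rapid_bounded (hf _ (slow_bounded_basis (m + 1))) (n + 1)
    refine ⟨r, fun i k => ?_⟩
    have h1 := hr _ ⟨_, ⟨k, rfl⟩, rfl⟩
    have h2 := norm_apply_le ((f (((k : ℕ) : ℂ) ^ (((m + 1 : ℕ)) : ℤ) • incl (basisVec k))).wfinite
      (n + 1)) i
    refine le_trans (le_of_eq ?_) (h2.trans h1.le)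
    rw [map_smul, Rapid.seq_smul, Pi.smul_apply, smul_eq_mul, RCLike.norm_conj]
    simp only [norm_mul, norm_zpow, Complex.norm_natCast]
    push_cast
    ring
  let d : ℕ+ → Rapid := fun i => ⟨d₀ i, fun m => (wfinite_of_bound ((hd m).choose_spec i)).1⟩
  have hdB : Bornology.IsVonNBounded ℂ (Set.range d) := by
    rw [rapid_withSeminorms.isVonNBounded_iff_seminorm_bounded]
    intro m
    obtain ⟨C, hC⟩ := hd m
    refine ⟨max (Real.sqrt (∑' j : ℕ+, ((j : ℕ) : ℝ) ^ (-2 : ℤ)) * C) 0 + 1, by positivity, ?_⟩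
    rintro _ ⟨i, rfl⟩
    have := (wfinite_of_bound (hC i)).2
    exact (this.trans (le_max_left _ _)).trans_lt (lt_add_one _)
  have hpair : ∀ i ξ, pair (d i) ξ = conj (((i : ℕ) : ℂ) ^ ((n : ℤ) + 1) * (f ξ).seq i) := by
    intro i ξ
    have h1 := ((hsum ξ).map (functional (incl (basisVec i)))
      (functional (incl (basisVec i))).continuous).mul_left (((i : ℕ) : ℂ) ^ ((n : ℤ) + 1))
    have h2 := h1.map (starRingEnd ℂ) Complex.continuous_conj
    simp only [functional_apply, pair_basisVec_right] at h2
    rw [← h2.tsum_eq]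
    refine tsum_congr fun k => ?_
    change conj (_ * (f (incl (basisVec k))).seq i) * conj (ξ.seq k) = _
    simp only [Function.comp, functional_apply, pair_basisVec_right, Rapid.seq_smul,
      Pi.smul_apply, smul_eq_mul, map_mul]
    ring
  obtain ⟨δ, hδ, hδε⟩ := exists_wnorm_lt n hε
  filter_upwards [slow_eventually hdB hδ] with ξ hξ
  rw [sub_zero]
  refine hδε fun i => ?_
  have := (hξ _ ⟨i, rfl⟩).le
  rwa [hpair, RCLike.norm_conj, norm_scaled] at this

/-- A limit, uniform on bounded sets, of operators in `𝒮` is linear and maps bounded sets to bounded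
sets; by `continuous_of_isVonNBounded_image` it belongs to `𝒮`. -/
instance : CompleteSpace NCSchwartz := by
  rw [completeSpace_iff_isComplete_range
    (ContinuousLinearMap.isUniformEmbedding_toUniformOnFun (𝕜₁ := ℂ) (𝕜₂ := ℂ)).isUniformInducing]
  set 𝔖 : Set (Set Slow) := {B | Bornology.IsVonNBounded ℂ B}
  refine IsClosed.isComplete (isClosed_of_closure_subset fun g hg => ?_)
  obtain ⟨F, hF, hlim⟩ : ∃ F : Filter (UniformOnFun Slow Rapid 𝔖), F.NeBot ∧ F ≤ 𝓝 g ∧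
      ∀ᶠ h in F, h ∈ Set.range fun x : NCSchwartz => UniformOnFun.ofFun 𝔖 x :=
    ⟨𝓝[_] g, mem_closure_iff_nhdsWithin_neBot.1 hg, nhdsWithin_le_nhds, self_mem_nhdsWithin⟩
  have hunif := UniformOnFun.tendsto_iff_tendstoUniformlyOn.1 (tendsto_id'.2 hlim.1)
  -- the limit is linear, as a pointwise limit of linear maps
  have hpt : ∀ ξ, Tendsto (fun h : UniformOnFun Slow Rapid 𝔖 => UniformOnFun.toFun 𝔖 h ξ) F
      (𝓝 (UniformOnFun.toFun 𝔖 g ξ)) := fun ξ =>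
    (hunif {ξ} (Bornology.isVonNBounded_singleton ξ)).tendsto_at rfl
  let f : Slow →ₗ[ℂ] Rapid :=
    { toFun := UniformOnFun.toFun 𝔖 g
      map_add' := fun ξ η => by
        refine tendsto_nhds_unique_of_eventuallyEq (hpt _) ((hpt ξ).add (hpt η)) ?_
        filter_upwards [hlim.2]
        rintro _ ⟨x, rfl⟩
        exact map_add x ξ η
      map_smul' := fun c ξ => by
        refine tendsto_nhds_unique_of_eventuallyEq (hpt _) ((hpt ξ).const_smul c) ?_
        filter_upwards [hlim.2]
        rintro _ ⟨x, rfl⟩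
        exact map_smul x c ξ }
  have hf : ∀ B, Bornology.IsVonNBounded ℂ B → Bornology.IsVonNBounded ℂ (f '' B) := by
    intro B hB
    rw [rapid_withSeminorms.isVonNBounded_iff_seminorm_bounded]
    intro n
    have hV : {q : Rapid × Rapid | wnorm n (q.2 - q.1).seq < 1} ∈ uniformity Rapid := by
      rw [uniformity_eq_comap_nhds_zero]
      exact preimage_mem_comap (((continuous_wnorm n).tendsto' 0 0
        (by simp [wnorm_zero])).eventually (gt_mem_nhds one_pos))
    obtain ⟨_, h1, x, rfl⟩ := ((hunif B hB _ hV).and hlim.2).exists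
    obtain ⟨r, hr, h2⟩ := rapid_bounded (hB.image x) n
    refine ⟨r + 1, by positivity, ?_⟩
    rintro _ ⟨ξ, hξ, rfl⟩
    have h3 : rapidNorm n (x ξ - f ξ) < 1 := h1 ξ hξ
    have h4 : rapidNorm n (x ξ) < r := h2 _ ⟨ξ, hξ, rfl⟩
    have h5 := map_sub_le_add (rapidNorm n) (x ξ) (x ξ - f ξ)
    rw [sub_sub_cancel] at h5
    linarith
  exact ⟨⟨f, continuous_of_isVonNBounded_image f hf⟩, rfl⟩

/-- `slow_bounded_equicontinuous` with a positive constant. -/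
theorem pair_le_mul_wnorm {A : Set Slow} (hA : Bornology.IsVonNBounded ℂ A) :
    ∃ m : ℕ, ∃ C > 0, ∀ ζ ∈ A, ∀ η, ‖pair η ζ‖ ≤ C * wnorm m η.seq := by
  obtain ⟨m, C, h⟩ := slow_bounded_equicontinuous hA
  refine ⟨m, max C 1, by positivity, fun ζ hζ η => (h ζ hζ η).trans ?_⟩
  exact mul_le_mul_of_nonneg_right (le_max_left _ _) (wnorm_nonneg _ _)

/-- The involution of `𝒮` is continuous: `|x^* η|_n` for `η` in a bounded set is dominated by the
numbers `⟨x ξ, η⟩` with `ξ` in the bounded set `{i^(n+1) e_i}`. -/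
instance : ContinuousStar NCSchwartz := by
  refine ⟨continuous_of_continuousAt_zero (starAddEquiv : NCSchwartz ≃+ NCSchwartz) ?_⟩
  rw [ContinuousAt, map_zero, tendsto_rapid_zero_iff]
  intro B hB n ε hε
  obtain ⟨m, C, hC, hle⟩ := pair_le_mul_wnorm hB
  obtain ⟨δ, hδ, hδε⟩ := exists_wnorm_lt n hε
  filter_upwards [tendsto_rapid_zero_iff.1 tendsto_id _ (slow_bounded_basis (n + 1)) m (δ / C)
    (by positivity)] with x hx η hη
  refine hδε (adjSeq_bound x η n ?_)
  rintro _ ⟨ξ, hξ, rfl⟩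
  refine (hle η hη _).trans ?_
  rw [← le_div_iff₀' hC]
  exact (hx ξ hξ).le

/-! ### One-dimensional operators -/

theorem continuous_coord (i : ℕ+) : Continuous fun ξ : Rapid => ξ.seq i := by
  simpa only [pair_basisVec_right] using continuous_pair_left (incl (basisVec i))

theorem pair_basisVec_self (i : ℕ+) : pair (basisVec i) (incl (basisVec i)) = 1 := by
  rw [pair_basisVec_right, basisVec_seq, Pi.single_eq_same]

theorem rankOne_basisVec (a : Rapid) (i : ℕ+) :
    rankOne a (basisVec i) (incl (basisVec i)) = a := by
  rw [rankOne_apply, pair_basisVec_self, map_one, one_smul]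

theorem mul_rankOne (x : NCSchwartz) (a b : Rapid) :
    x * rankOne a b = rankOne (x (incl a)) b := by
  ext ξ
  rw [mul_def, rankOne_apply, rankOne_apply, map_smul, map_smul]

theorem star_rankOne (a b : Rapid) : star (rankOne a b) = rankOne b a :=
  (eq_star fun η ξ => by
    rw [rankOne_apply, rankOne_apply, pair_smul_left, pair_smul_left, map_mul,
      Complex.conj_conj, mul_comm]).symm

theorem isVonNBounded_rankOne {A D : Set Rapid} (hA : Bornology.IsVonNBounded ℂ A)
    (hD : Bornology.IsVonNBounded ℂ D) :
    Bornology.IsVonNBounded ℂ (Set.image2 rankOne A D) := by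
  rw [ContinuousLinearMap.isVonNBounded_iff]
  intro B hB
  rw [rapid_withSeminorms.isVonNBounded_iff_seminorm_bounded]
  intro n
  obtain ⟨C, hC⟩ := slow_bounded_pair hB hD
  obtain ⟨r, hr, hA⟩ := rapid_bounded hA n
  refine ⟨max C 0 * r + 1, by positivity, ?_⟩
  rintro _ ⟨_, ⟨a, ha, b, hb, rfl⟩, ξ, hξ, rfl⟩
  change wnorm n (rankOne a b ξ).seq < _
  rw [rankOne_apply, Rapid.seq_smul, wnorm_smul _ (a.wfinite n),
    RCLike.norm_conj]
  refine lt_of_le_of_lt ?_ (lt_add_one _)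
  exact mul_le_mul ((hC b hb ξ hξ).trans (le_max_left _ _)) (hA a ha).le (wnorm_nonneg _ _)
    (le_max_right _ _)

/-- Continuous linear maps on `s'` are determined by their restriction to `s`. -/
theorem clm_ext_incl {F : Type*} [AddCommGroup F] [Module ℂ F] [TopologicalSpace F] [T2Space F]
    {f g : Slow →L[ℂ] F} (h : ∀ c, f (incl c) = g (incl c)) : f = g := by
  refine ContinuousLinearMap.ext fun ξ => ?_
  have hf := (slow_hasSum ξ).map f f.continuous
  have hg := (slow_hasSum ξ).map g g.continuous
  have : (f ∘ fun i => ξ.seq i • incl (basisVec i)) = g ∘ fun i => ξ.seq i • incl (basisVec i) :=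
    funext fun i => by simp only [Function.comp, map_smul, h]
  exact hf.unique (this ▸ hg)

/-! ### The adjoint of an operator on `s` -/

/-- The transpose `s' → s'` of an operator `v : s → s` with respect to the sesquilinear pairing. -/
def adjoint (v : Rapid →L[ℂ] Rapid) : Slow →L[ℂ] Slow :=
  have h : ∀ η, functional (exists_functional (functional η ∘L v)).choose = functional η ∘L v :=
    fun η => (exists_functional (functional η ∘L v)).choose_spec
  have hp : ∀ ξ η, pair ξ (exists_functional (functional η ∘L v)).choose = pair (v ξ) η :=
    fun ξ η => congrArg (fun φ => φ ξ) (h η)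
  { toFun := fun η => (exists_functional (functional η ∘L v)).choose
    map_add' := fun η η' => Slow.ext_pair fun ξ => by simp [pair_add_right, hp]
    map_smul' := fun c η => Slow.ext_pair fun ξ => by simp [pair_smul_right, hp]
    cont := by
      rw [functional_inducing.continuous_iff]
      have : (functionalₛₗ : Slow → StrongDual ℂ Rapid) ∘
          (fun η => (exists_functional (functional η ∘L v)).choose) =
          ContinuousLinearMap.precomp ℂ v ∘ functionalₛₗ := funext h
      exact this ▸ (ContinuousLinearMap.precomp ℂ v).continuous.comp
        functional_inducing.continuous }

theorem pair_adjoint (v : Rapid →L[ℂ] Rapid) (ξ : Rapid) (η : Slow) :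
    pair ξ (adjoint v η) = pair (v ξ) η :=
  congrArg (fun φ => φ ξ) (exists_functional (functional η ∘L v)).choose_spec

/-! ### The multiplier of a double centralizer -/

namespace DC

theorem L_mul {A : Type*} [NonUnitalRing A] [Faithful A] (p : DC A) (x y : A) :
    p.L (x * y) = p.L x * y := by
  refine sub_eq_zero.1 (Faithful.right _ fun z => ?_)
  rw [mul_sub, p.central, ← mul_assoc, ← mul_assoc, p.central, sub_self]

theorem star_L {A : Type*} [NonUnitalRing A] [StarRing A] (p : DC A) (x : A) :
    (star p).L x = star (p.R (star x)) := rfl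

variable (p : DC NCSchwartz)

/-- The operator `a ↦ L(⟨·, e₁⟩ a) e₁` on `s` as a linear map. If `L` is left multiplication by `u`,
this is `u`. -/
def symbolLin : Rapid →ₗ[ℂ] Rapid where
  toFun a := p.L (rankOne a (basisVec 1)) (incl (basisVec 1))
  map_add' a b := by
    have : rankOne (a + b) (basisVec 1) = rankOne a (basisVec 1) + rankOne b (basisVec 1) := by
      ext ξ; simp [rankOne_apply]
    rw [this, L_add]; rfl
  map_smul' c a := by
    have : rankOne (c • a) (basisVec 1) = c • rankOne a (basisVec 1) := by
      ext ξ; rw [rankOne_apply, smul_comm]; rfl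
    rw [this, L_smul]; rfl

theorem symbolLin_apply (a : Rapid) :
    p.symbolLin a = p.L (rankOne a (basisVec 1)) (incl (basisVec 1)) := rfl

/-- The centralizer identity `x L(y) = R(x) y` for one-dimensional `x` and `y`. -/
theorem pair_symbolLin (a b : Rapid) :
    pair (p.symbolLin a) (incl b) = (p.R (rankOne (basisVec 1) b) (incl a)).seq 1 := by
  have h := congrArg (fun z : NCSchwartz => (z (incl (basisVec 1))).seq 1)
    (p.central (rankOne (basisVec 1) b) (rankOne a (basisVec 1)))
  simp only [mul_def, rankOne_basisVec, ← symbolLin_apply] at h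
  rw [← h, rankOne_apply, pair_incl b, Complex.conj_conj, Rapid.seq_smul, basisVec_seq]
  simp

theorem continuous_symbolLin : Continuous p.symbolLin := by
  refine continuous_of_continuous_coord _ fun i => ?_
  simp only [← pair_basisVec_right, pair_symbolLin]
  simp only [pair_basisVec_right]
  exact (continuous_coord 1).comp ((p.R _).continuous.comp incl.continuous)

/-- The operator `u ∈ L(s)` of which `L` is the left multiplication. -/
def symbol : Rapid →L[ℂ] Rapid := ⟨p.symbolLin, p.continuous_symbolLin⟩

theorem symbol_apply (a : Rapid) :
    p.symbol a = p.L (rankOne a (basisVec 1)) (incl (basisVec 1)) := rfl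

theorem pair_symbol_star (a b : Rapid) :
    pair (p.symbol a) (incl b) = pair a (incl ((star p).symbol b)) := by
  rw [pair_incl a, symbol_apply (star p), star_L, star_rankOne, NCS.pair_star, Complex.conj_conj,
    pair_basisVec_right]
  exact p.pair_symbolLin a b

/-- The element of `L(s) ∩ L(s')` inducing the double centralizer `p`. The extension to `s'` is the
transpose of the operator belonging to `p^*`. -/
def multiplier : MulAlg :=
  ⟨(p.symbol, adjoint (star p).symbol), fun ξ => Slow.ext_pair fun ζ => by
    change pair ζ (adjoint _ (incl ξ)) = pair ζ (incl (p.symbol ξ))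
    rw [pair_adjoint, pair_incl ζ, pair_incl _ ξ, ← pair_symbol_star]⟩

theorem L_eq (y : NCSchwartz) : p.L y = p.multiplier.onRapid ∘L y := by
  refine clm_ext_incl fun c => ?_
  have h := congrArg (fun z : NCSchwartz => z (incl (basisVec 1)))
    (p.L_mul y (rankOne c (basisVec 1)))
  simp only [mul_rankOne, rankOne_basisVec] at h
  exact h.symm

theorem R_eq (x : NCSchwartz) : p.R x = x ∘L p.multiplier.onSlow := by
  refine sub_eq_zero.1 (Faithful.left _ fun y => ?_)
  rw [sub_mul, sub_eq_zero, ← p.central, L_eq]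
  ext ξ
  simp [mul_def, MulAlg.onSlow_incl]

theorem doubleRep_multiplier : doubleRep p.multiplier = p :=
  ext_apply (fun y => (p.L_eq y).symm) fun x => (p.R_eq x).symm

end DC

theorem multiplier_doubleRep (u : MulAlg) : (doubleRep u).multiplier = u :=
  MulAlg.ext_fst fun a => congrArg u.onRapid (rankOne_basisVec a 1)

theorem doubleRep_star (u : MulAlg) : doubleRep (star u) = star (doubleRep u) := by
  refine DC.ext_apply (fun x => ?_) fun x => ?_
  · refine eq_star fun η ξ => ?_
    change pair ((star u).onRapid (x η)) ξ = conj (pair (star x (u.onSlow ξ)) η)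
    rw [MulAlg.pair_star', pair_star, Complex.conj_conj]
  · refine eq_star fun η ξ => ?_
    change pair (x ((star u).onSlow η)) ξ = conj (pair (u.onRapid (star x ξ)) η)
    rw [← MulAlg.pair_star, pair_star, Complex.conj_conj]

/-- The isomorphism of `*`-algebras `u ↦ (L_u, R_u)`. -/
def doubleRepEquiv : MulAlg ≃⋆ₐ[ℂ] DC NCSchwartz where
  toFun := doubleRep
  invFun := DC.multiplier
  left_inv := multiplier_doubleRep
  right_inv := DC.doubleRep_multiplier
  map_mul' _ _ := rfl
  map_add' u v := DC.ext_apply (fun _ => rfl) fun x => by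
    ext ξ
    exact map_add x (u.onSlow ξ) (v.onSlow ξ)
  map_star' := doubleRep_star
  map_smul' c u := DC.ext_apply (fun _ => rfl) fun x => by
    ext ξ
    exact map_smul x c (u.onSlow ξ)

/-! ### The topology of the double centralizers -/

namespace DC

/-- A double centralizer as a pair of continuous linear operators on `𝒮`. -/
def toEnd : DC NCSchwartz →ₗ[ℂ] (NCSchwartz →L[ℂ] NCSchwartz) × (NCSchwartz →L[ℂ] NCSchwartz) where
  toFun p :=
    (⟨⟨⟨p.L, p.L_add⟩, p.L_smul⟩, by
      change Continuous p.L
      rw [funext p.L_eq]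
      exact (ContinuousLinearMap.postcomp Slow p.multiplier.onRapid).continuous⟩,
    ⟨⟨⟨p.R, p.R_add⟩, p.R_smul⟩, by
      change Continuous p.R
      rw [funext p.R_eq]
      exact (ContinuousLinearMap.precomp Rapid p.multiplier.onSlow).continuous⟩)
  map_add' _ _ := rfl
  map_smul' _ _ := rfl

theorem isUniformEmbedding_toEnd : IsUniformEmbedding toEnd := by
  have h := (ContinuousLinearMap.isUniformEmbedding_toUniformOnFun (𝕜₁ := ℂ) (𝕜₂ := ℂ)
    (σ := RingHom.id ℂ) (E := NCSchwartz) (F := NCSchwartz)).isUniformInducing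
  refine ⟨(h.prod h).of_comp_iff.1 ⟨rfl⟩, fun p q hpq => ?_⟩
  refine ext_apply (fun x => ?_) fun x => ?_
  · exact congrArg (fun z => z.1 x) hpq
  · exact congrArg (fun z => z.2 x) hpq

theorem isInducing_toEnd : IsInducing toEnd := isUniformEmbedding_toEnd.isUniformInducing.isInducing

instance : IsUniformAddGroup (DC NCSchwartz) :=
  isUniformEmbedding_toEnd.isUniformInducing.isUniformAddGroup toEnd

instance : ContinuousSMul ℂ (DC NCSchwartz) :=
  isInducing_toEnd.continuousSMul continuous_id (map_smul toEnd _ _)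

instance : LocallyConvexSpace ℝ (DC NCSchwartz) :=
  have : ContinuousConstSMul ℝ Rapid := ⟨fun c => continuous_const_smul (c : ℂ)⟩
  have : ContinuousConstSMul ℝ NCSchwartz := ⟨fun c => continuous_const_smul (c : ℂ)⟩
  have : LocallyConvexSpace ℝ NCSchwartz := ContinuousLinearMap.instLocallyConvexSpace ..
  have : LocallyConvexSpace ℝ (NCSchwartz →L[ℂ] NCSchwartz) :=
    ContinuousLinearMap.instLocallyConvexSpace ..
  IsInducing.locallyConvexSpace (f := toEnd.restrictScalars ℝ) isInducing_toEnd

instance : T2Space (DC NCSchwartz) := isUniformEmbedding_toEnd.isEmbedding.t2Space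

/-- The defining identity `x L(y) = R(x) y` is preserved under limits. -/
instance : CompleteSpace (DC NCSchwartz) := by
  set 𝔖 : Set (Set NCSchwartz) := {M | Bornology.IsVonNBounded ℂ M}
  let e : DC NCSchwartz →
      UniformOnFun NCSchwartz NCSchwartz 𝔖 × UniformOnFun NCSchwartz NCSchwartz 𝔖 :=
    fun p => (UniformOnFun.ofFun 𝔖 p.L, UniformOnFun.ofFun 𝔖 p.R)
  have he : IsUniformInducing e := ⟨rfl⟩
  rw [completeSpace_iff_isComplete_range he]
  have hrange : Set.range e = {q | ∀ x y, x * UniformOnFun.toFun 𝔖 q.1 y =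
      UniformOnFun.toFun 𝔖 q.2 x * y} :=
    Set.ext fun q => ⟨fun ⟨p, hp⟩ => hp ▸ p.central, fun h => ⟨⟨_, _, h⟩, rfl⟩⟩
  have heval : ∀ x, Continuous fun T : UniformOnFun NCSchwartz NCSchwartz 𝔖 =>
      UniformOnFun.toFun 𝔖 T x := fun x =>
    (UniformOnFun.uniformContinuous_eval_of_mem _ _ (Set.mem_singleton x)
      (Bornology.isVonNBounded_singleton x)).continuous
  rw [hrange]
  simp only [Set.ofPred_forall]
  refine IsClosed.isComplete (isClosed_iInter fun x => isClosed_iInter fun y => isClosed_eq ?_ ?_)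
  · exact (ContinuousLinearMap.postcomp Slow (x ∘L incl)).continuous.comp
      ((heval y).comp continuous_fst)
  · exact (ContinuousLinearMap.precomp Rapid (incl ∘L y)).continuous.comp
      ((heval x).comp continuous_snd)

theorem tendsto_zero_iff {ι : Type*} {l : Filter ι} {f : ι → DC NCSchwartz} :
    Tendsto f l (𝓝 0) ↔ ∀ M : Set NCSchwartz, Bornology.IsVonNBounded ℂ M →
      ∀ B : Set Slow, Bornology.IsVonNBounded ℂ B → ∀ (n : ℕ), ∀ ε > 0,
      ∀ᶠ i in l, ∀ x ∈ M, ∀ ξ ∈ B,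
        wnorm n ((f i).L x ξ).seq < ε ∧ wnorm n ((f i).R x ξ).seq < ε := by
  rw [isInducing_toEnd.tendsto_nhds_iff, LinearMap.map_zero, Prod.zero_eq_mk, nhds_prod_eq,
    tendsto_prod_iff', tendsto_nCSchwartz_end_zero_iff, tendsto_nCSchwartz_end_zero_iff]
  constructor
  · intro h M hM B hB n ε hε
    filter_upwards [h.1 M hM B hB n ε hε, h.2 M hM B hB n ε hε] with i h1 h2 x hx ξ hξ
    exact ⟨h1 x hx ξ hξ, h2 x hx ξ hξ⟩
  · intro h
    constructor <;> intro M hM B hB n ε hε <;>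
      filter_upwards [h M hM B hB n ε hε] with i hi x hx ξ hξ
    exacts [(hi x hx ξ hξ).1, (hi x hx ξ hξ).2]

instance : SeparatelyContinuousMul (DC NCSchwartz) where
  continuous_const_mul {p} := isInducing_toEnd.continuous_iff.2 <|
    ((ContinuousLinearMap.postcomp NCSchwartz (toEnd p).1).continuous.comp continuous_fst).prodMk
      ((ContinuousLinearMap.precomp NCSchwartz (toEnd p).2).continuous.comp continuous_snd)
      |>.comp isInducing_toEnd.continuous
  continuous_mul_const {p} := isInducing_toEnd.continuous_iff.2 <|
    ((ContinuousLinearMap.precomp NCSchwartz (toEnd p).1).continuous.comp continuous_fst).prodMk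
      ((ContinuousLinearMap.postcomp NCSchwartz (toEnd p).2).continuous.comp continuous_snd)
      |>.comp isInducing_toEnd.continuous

instance : ContinuousStar (DC NCSchwartz) := by
  let σ : NCSchwartz →L⋆[ℂ] NCSchwartz :=
    (starL ℂ : NCSchwartz ≃L⋆[ℂ] NCSchwartz).toContinuousLinearMap
  let conjBy : (NCSchwartz →L[ℂ] NCSchwartz) → (NCSchwartz →L[ℂ] NCSchwartz) :=
    fun T => σ.comp (T.comp σ)
  have hc : Continuous conjBy :=
    (ContinuousLinearMap.postcomp NCSchwartz σ).continuous.comp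
      (ContinuousLinearMap.precomp NCSchwartz σ).continuous
  refine ⟨isInducing_toEnd.continuous_iff.2 ?_⟩
  exact ((hc.comp continuous_snd).prodMk (hc.comp continuous_fst)).comp isInducing_toEnd.continuous

end DC

/-! ### The isomorphism is a homeomorphism -/

instance : IsTopologicalAddGroup MulAlg :=
  inferInstanceAs (IsTopologicalAddGroup (Subalgebra.toSubmodule mulSubalgebra))

-- A shortcut that keeps instance search for the addition of `MulAlg` within its default limits.
instance : ContinuousAdd MulAlg := IsTopologicalAddGroup.toContinuousAdd

theorem MulAlg.tendsto_zero_iff {ι : Type*} {l : Filter ι} {f : ι → MulAlg} :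
    Tendsto f l (𝓝 0) ↔ Tendsto (fun i => (f i).onRapid) l (𝓝 0) ∧
      Tendsto (fun i => (f i).onSlow) l (𝓝 0) := by
  rw [IsInducing.subtypeVal.tendsto_nhds_iff]
  change Tendsto _ l (𝓝 (0, 0)) ↔ _
  rw [nhds_prod_eq, tendsto_prod_iff']
  rfl

/-- The part of the claim concerning `R_u` uses `⟨ζ, x ũ ξ⟩ = ⟨x^* ζ, ũ ξ⟩`: when `x` runs through
a bounded subset of `𝒮`, and `ζ` through a bounded subset of `s'`, `x^* ζ` stays in a bounded subset
of `s`. -/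
theorem continuous_doubleRepEquiv : Continuous doubleRepEquiv := by
  refine continuous_of_continuousAt_zero doubleRepEquiv ?_
  rw [ContinuousAt, map_zero, DC.tendsto_zero_iff]
  intro M hM B hB n ε hε
  obtain ⟨h1, h2⟩ := MulAlg.tendsto_zero_iff.1 (tendsto_id (x := 𝓝 (0 : MulAlg)))
  have hMB : Bornology.IsVonNBounded ℂ (Set.image2 (fun (x : NCSchwartz) ξ => x ξ) M B) :=
    ContinuousLinearMap.isVonNBounded_image2_apply hM hB
  have hMstar : Bornology.IsVonNBounded ℂ (star '' M) :=
    hM.image (starL ℂ : NCSchwartz ≃L⋆[ℂ] NCSchwartz).toContinuousLinearMap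
  have hD : Bornology.IsVonNBounded ℂ (Set.image2 (fun (x : NCSchwartz) ξ => x ξ) (star '' M)
      (Set.range fun i : ℕ+ => ((i : ℕ) : ℂ) ^ ((n + 1 : ℕ) : ℤ) • incl (basisVec i))) :=
    ContinuousLinearMap.isVonNBounded_image2_apply hMstar (slow_bounded_basis (n + 1))
  obtain ⟨δ, hδ, hδε⟩ := exists_wnorm_lt n hε
  filter_upwards [tendsto_rapid_zero_iff.1 h1 _ hMB n ε hε,
    tendsto_slow_zero_iff.1 h2 B hB _ hD _ hδ] with u hu1 hu2 x hx ξ hξ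
  refine ⟨hu1 _ ⟨x, hx, ξ, hξ, rfl⟩, ?_⟩
  change wnorm n (x (u.onSlow ξ)).seq < ε
  refine hδε fun i => ?_
  have h := hu2 ξ hξ _ ⟨_, ⟨x, hx, rfl⟩, _, ⟨i, rfl⟩, rfl⟩
  simp only [map_smul, pair_smul_left, pair_star, pair_basisVec_right, id] at h
  refine le_trans (le_of_eq ?_) h.le
  simp only [norm_mul, norm_zpow, Complex.norm_natCast, RCLike.norm_conj]
  push_cast
  ring

theorem continuous_doubleRepEquiv_symm : Continuous doubleRepEquiv.symm := by
  refine continuous_of_continuousAt_zero doubleRepEquiv.symm ?_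
  rw [ContinuousAt, map_zero, MulAlg.tendsto_zero_iff, tendsto_rapid_zero_iff,
    tendsto_slow_zero_iff]
  have h := DC.tendsto_zero_iff.1 (tendsto_id (x := 𝓝 (0 : DC NCSchwartz)))
  have he : Bornology.IsVonNBounded ℂ {basisVec 1} := Bornology.isVonNBounded_singleton _
  refine ⟨fun B hB n ε hε => ?_, fun B hB D hD ε hε => ?_⟩
  · -- `u a = L(⟨·, e₁⟩ a) e₁`
    filter_upwards [h _ (isVonNBounded_rankOne hB he) {incl (basisVec 1)}
      (Bornology.isVonNBounded_singleton _) n ε hε] with p hp a ha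
    exact (hp _ ⟨a, ha, _, rfl, rfl⟩ _ rfl).1
  · -- `R(⟨·, η⟩ e₁) ξ = ⟨ũ ξ, η⟩ e₁`
    filter_upwards [h _ (isVonNBounded_rankOne he hD) B hB 0 ε hε] with p hp ξ hξ η hη
    change ‖pair η (p.multiplier.onSlow ξ)‖ < ε
    have := (hp _ ⟨_, rfl, η, hη, rfl⟩ ξ hξ).2
    rw [id, p.R_eq, ContinuousLinearMap.comp_apply, rankOne_apply, Rapid.seq_smul,
      wnorm_smul _ ((basisVec 1).wfinite 0), RCLike.norm_conj, basisVec_seq, wnorm_single] at this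
    simpa using this

end

end NCS

theorem theorem3 :
    (∃ φ : NCS.MulAlg ≃⋆ₐ[ℂ] NCS.DC NCS.NCSchwartz,
      (∀ u, φ u = NCS.doubleRep u) ∧ IsHomeomorph φ) ∧
    (∃ j : NCS.DC NCS.NCSchwartz →
        (NCS.NCSchwartz →L[ℂ] NCS.NCSchwartz) × (NCS.NCSchwartz →L[ℂ] NCS.NCSchwartz),
      (∀ p, ⇑(j p).1 = p.L ∧ ⇑(j p).2 = p.R) ∧ IsUniformEmbedding j) ∧
    IsUniformAddGroup (NCS.DC NCS.NCSchwartz) ∧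
    ContinuousSMul ℂ (NCS.DC NCS.NCSchwartz) ∧
    LocallyConvexSpace ℝ (NCS.DC NCS.NCSchwartz) ∧
    T2Space (NCS.DC NCS.NCSchwartz) ∧
    CompleteSpace (NCS.DC NCS.NCSchwartz) ∧
    SeparatelyContinuousMul (NCS.DC NCS.NCSchwartz) ∧
    ContinuousStar (NCS.DC NCS.NCSchwartz) :=
  ⟨⟨NCS.doubleRepEquiv, fun _ => rfl, isHomeomorph_iff_exists_inverse.2
      ⟨NCS.continuous_doubleRepEquiv, NCS.doubleRepEquiv.symm, NCS.multiplier_doubleRep,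
        NCS.DC.doubleRep_multiplier, NCS.continuous_doubleRepEquiv_symm⟩⟩,
    ⟨NCS.DC.toEnd, fun _ => ⟨rfl, rfl⟩, NCS.DC.isUniformEmbedding_toEnd⟩,
    inferInstance, inferInstance, inferInstance, inferInstance, inferInstance, inferInstance,
    inferInstance⟩
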